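/- **Conventions.** A *cube complex* is a complex of Euclidean unit cubes in which every cube is embedded and any two cubes that meet intersect in a common face. It is *CAT(0)* if it is simply connected and the link of every vertex is a flag complex (no finiteness of any kind is assumed). Its hyperplanes are dual to the classes of edges under the equivalence relation generated by being opposite edges of a square; its *halfspaces* $\Phi\in\mathcal H(X)$ are the connected components of complements of hyperplanes, regarded as sets of vertices, and $\overline\Phi$ denotes the complement of $\Phi$. Halfspaces $\Phi,\Psi$ are *nested* if $\Phi\subseteq\Psi$, $\overline\Phi\subseteq\Psi$, $\Phi\subseteq\overline\Psi$ or $\overline\Phi\subseteq\overline\Psi$, and *transverse* otherwise. Distinct nested halfspaces $\Phi,\Psi$ are *tightly nested* if there is no $\Theta\in\mathcal H(X)$ with $\Phi'\subsetneq\Theta\subsetneq\Psi'$ for some $\Phi'\in\{\Phi,\overline\Phi\}$, $\Psi'\in\{\Psi,\overline\Psi\}$. An action of a group $G$ by automorphisms on a CAT(0) cube complex $X$ is *RAAG-like* if 1. there are no $\Phi\in\mathcal H(X)$, $h\in G$ with $h\overline\Phi=\Phi$; 2. there are no $\Phi\in\mathcal H(X)$, $h\in G$ with $\Phi$ and $h\Phi$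 transverse; 3. there are no tightly nested $\Phi,\Phi'\in\mathcal H(X)$ and $h\in G$ with $\Phi$ and $h\Phi'$ transverse; 4. there are no $\Phi\in\mathcal H(X)$, $h\in G$ with $\Phi\subseteq h\overline\Phi$ and $\Phi$, $h\overline\Phi$ tightly nested. A group is *RAAG-like* if it has a faithful RAAG-like action on some CAT(0) cube complex. The *right-angled Artin group* (RAAG) of a simplicial graph $\Gamma$ is generated by the vertices of $\Gamma$, subject to the relations that adjacent vertices commute. For $g\in[G,G]$ let $\mathrm{cl}(g)$ be the minimal number of commutators whose product is $g$, and let $\mathrm{scl}(g)=\lim_{n\to\infty}\mathrm{cl}(g^n)/n$ (the limit exists). A group $G$ has a *stable commutator length gap* of $c$ if $\mathrm{scl}(g)\ge c$ for every $g\in[G,G]$ with $g\neq1$. **Corollary.** Let $G$ be a group with a RAAG-like action on a CAT(0) cube complex. Then every $g\in[G,G]$ that acts non-trivially satisfies $$\mathrm{scl}(g)\ge\tfrac1{24}.$$ In particular, every RAAG-like group has a stable commutator length gap of $1/24$. Hence so does every right-angled Artin group. -/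

import Mathlib

open Filter Topology
open scoped Pointwise commutatorElement

universe u v w

/-- The face of the combinatorial cube `{0,1}^n` on which the coordinates in `S` agree with
those of `a`. -/
def cubeFace {n : ℕ} (S : Set (Fin n)) (a : Fin n → Bool) : Set (Fin n → Bool) :=
  {x | ∀ i ∈ S, x i = a i}

/-- A cube complex with vertex set `V`, each cube being recorded by its set of vertices: cubes
are embedded copies of `{0,1}^n` (for some `n`), the subcubes of a cube are exactly its faces,
and two cubes that meet do so in a common face. -/
structure CubeComplex (V : Type*) where
  cubes : Set (Set V)
  singleton_mem : ∀ v : V, {v} ∈ cubes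
  exists_param : ∀ C ∈ cubes, ∃ (n : ℕ) (f : (Fin n → Bool) → V), Function.Injective f ∧
    Set.range f = C ∧ ∀ D ⊆ C, (D ∈ cubes ↔ ∃ S a, D = f '' cubeFace S a)
  inter_mem : ∀ C ∈ cubes, ∀ D ∈ cubes, (C ∩ D).Nonempty → C ∩ D ∈ cubes

namespace CubeComplex

variable {V : Type*} (X : CubeComplex V)

/-- The 1-skeleton. -/
def skeleton : SimpleGraph V where
  Adj u v := u ≠ v ∧ ({u, v} : Set V) ∈ X.cubes
  symm := ⟨fun u v h => ⟨h.1.symm, by rw [Set.pair_comm]; exact h.2⟩⟩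
  loopless := ⟨fun _ h => h.1 rfl⟩

/-- `a, b, c, d` are, in cyclic order, the vertices of a 2-cube. -/
structure IsSquare (a b c d : V) : Prop where
  adj_ab : X.skeleton.Adj a b
  adj_bc : X.skeleton.Adj b c
  adj_cd : X.skeleton.Adj c d
  adj_da : X.skeleton.Adj d a
  ne_ac : a ≠ c
  ne_bd : b ≠ d
  mem : ({a, b, c, d} : Set V) ∈ X.cubes

/-- Homotopy of edge paths relative to their endpoints: the congruence generated by removing
backtracks and by pushing across squares. -/
inductive Homotopic : ∀ {u v : V}, X.skeleton.Walk u v → X.skeleton.Walk u v → Prop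
  | refl {u v : V} (p : X.skeleton.Walk u v) : Homotopic p p
  | symm {u v : V} {p q : X.skeleton.Walk u v} : Homotopic p q → Homotopic q p
  | trans {u v : V} {p q r : X.skeleton.Walk u v} :
      Homotopic p q → Homotopic q r → Homotopic p r
  | append {u v w : V} {p p' : X.skeleton.Walk u v} {q q' : X.skeleton.Walk v w} :
      Homotopic p p' → Homotopic q q' → Homotopic (p.append q) (p'.append q')
  | backtrack {u v : V} (h : X.skeleton.Adj u v) :
      Homotopic (.cons h (.cons h.symm .nil)) .nil
  | square {a b c d : V} (h : X.IsSquare a b c d) :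
      Homotopic (.cons h.adj_ab (.cons h.adj_bc .nil))
        (.cons h.adj_da.symm (.cons h.adj_cd.symm .nil))

/-- The complex is (nonempty,) connected and its edge path group is trivial. -/
def IsSimplyConnected : Prop :=
  X.skeleton.Connected ∧ ∀ (v : V) (p : X.skeleton.Walk v v), X.Homotopic p .nil

/-- The link of every vertex is a flag complex: finitely many edges at `v` that pairwise lie in
a common cube all lie in a common cube. -/
def HasFlagLinks : Prop :=
  ∀ (v : V) (S : Set V), S.Finite → (∀ u ∈ S, X.skeleton.Adj v u) →
    (∀ u ∈ S, ∀ u' ∈ S, u ≠ u' → ∃ C ∈ X.cubes, v ∈ C ∧ u ∈ C ∧ u' ∈ C) →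
    ∃ C ∈ X.cubes, v ∈ C ∧ S ⊆ C

/-- CAT(0) cube complexes: simply connected with flag links. -/
structure IsCAT0 : Prop where
  simplyConnected : X.IsSimplyConnected
  flag : X.HasFlagLinks

/-- `e` and `e'` are opposite edges of a square. -/
def Opposite (e e' : Sym2 V) : Prop :=
  ∃ a b c d, X.IsSquare a b c d ∧ e = s(a, b) ∧ e' = s(d, c)

/-- Two edges are parallel if they are dual to the same hyperplane. -/
def Parallel : Sym2 V → Sym2 V → Prop :=
  Relation.EqvGen X.Opposite

/-- The vertices that can be joined to `a` without crossing the hyperplane dual to the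
edge `ab`. -/
def side (a b : V) : Set V :=
  {x | (X.skeleton.deleteEdges {e | X.Parallel s(a, b) e}).Reachable a x}

/-- Halfspaces, as sets of vertices: the components of the complement of a hyperplane. -/
def halfspaces : Set (Set V) :=
  {Φ | ∃ a b, X.skeleton.Adj a b ∧ Φ = X.side a b}

/-- Nestedness of halfspaces. -/
def Nested (Φ Ψ : Set V) : Prop :=
  Φ ⊆ Ψ ∨ Φᶜ ⊆ Ψ ∨ Φ ⊆ Ψᶜ ∨ Φᶜ ⊆ Ψᶜ

/-- Transversality of halfspaces. -/
def Transverse (Φ Ψ : Set V) : Prop :=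
  ¬ Nested Φ Ψ

/-- Distinct nested halfspaces with no halfspace strictly in between, for any choice of
orientations. -/
structure TightlyNested (Φ Ψ : Set V) : Prop where
  ne : Φ ≠ Ψ
  nested : Nested Φ Ψ
  tight : ¬ ∃ Θ ∈ X.halfspaces,
    (Φ ⊂ Θ ∧ Θ ⊂ Ψ) ∨ (Φᶜ ⊂ Θ ∧ Θ ⊂ Ψ) ∨ (Φ ⊂ Θ ∧ Θ ⊂ Ψᶜ) ∨ (Φᶜ ⊂ Θ ∧ Θ ⊂ Ψᶜ)

/-- The action on vertices is an action by automorphisms of the cube complex. -/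
def IsAction (G : Type*) [Group G] [MulAction G V] : Prop :=
  ∀ (g : G), ∀ C ∈ X.cubes, g • C ∈ X.cubes

/-- RAAG-like actions. -/
structure IsRAAGLikeAction (G : Type*) [Group G] [MulAction G V] : Prop where
  isAction : X.IsAction G
  no_inversion : ¬ ∃ Φ ∈ X.halfspaces, ∃ h : G, h • Φᶜ = Φ
  nonTransverse : ¬ ∃ Φ ∈ X.halfspaces, ∃ h : G, Transverse Φ (h • Φ)
  no_interosculation : ¬ ∃ Φ ∈ X.halfspaces, ∃ Φ' ∈ X.halfspaces, ∃ h : G,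
    X.TightlyNested Φ Φ' ∧ Transverse Φ (h • Φ')
  no_selfosculation : ¬ ∃ Φ ∈ X.halfspaces, ∃ h : G,
    Φ ⊆ h • Φᶜ ∧ X.TightlyNested Φ (h • Φᶜ)

end CubeComplex

/-- A group is RAAG-like if it has a faithful RAAG-like action on some CAT(0) cube complex. -/
def IsRAAGLikeGroup (G : Type u) [Group G] : Prop :=
  ∃ (V : Type v) (_ : MulAction G V) (X : CubeComplex V),
    X.IsCAT0 ∧ X.IsRAAGLikeAction G ∧ FaithfulSMul G V

/-- The right-angled Artin group of a graph: one generator for each vertex, and two generators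
commute if they are adjacent. -/
abbrev RAAG {W : Type*} (Γ : SimpleGraph W) : Type _ :=
  PresentedGroup {r : FreeGroup W | ∃ a b, Γ.Adj a b ∧ r = ⁅FreeGroup.of a, FreeGroup.of b⁆}

/-- Commutator length: the minimal number of commutators whose product is `g`
(used for `g` in the commutator subgroup only). -/
noncomputable def commutatorLength {G : Type*} [Group G] (g : G) : ℕ :=
  sInf {n | ∃ l : List G, l.length = n ∧ (∀ x ∈ l, x ∈ commutatorSet G) ∧ l.prod = g}

/-- Stable commutator length. -/
noncomputable def scl {G : Type*} [Group G] (g : G) : ℝ :=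
  limUnder atTop (fun n : ℕ => (commutatorLength (g ^ n) : ℝ) / n)

/-- The limit defining `scl g` exists, and `scl g ≥ c`. -/
def SclAtLeast {G : Type*} [Group G] (g : G) (c : ℝ) : Prop :=
  Tendsto (fun n : ℕ => (commutatorLength (g ^ n) : ℝ) / n) atTop (𝓝 (scl g)) ∧ c ≤ scl g

/-- `G` has a stable commutator length gap of `c`. -/
def HasSclGap (G : Type*) [Group G] (c : ℝ) : Prop :=
  ∀ g ∈ commutator G, g ≠ 1 → SclAtLeast g c

/-!
An antisymmetric quasimorphism of defect `D` is at most `4 * D * k` on a product of `k` commutators,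
so it suffices to find, for every `g` that acts non-trivially, such a quasimorphism with `D = 3`
that grows like `n` on the powers `g ^ n`; this gives the bound `1 / 12`.

At a vertex of minimal displacement, the first edge of a geodesic from `x` to `g • x` determines a
halfspace `Φ` with `g • Φ ⊂ Φ`. As no halfspace is transverse to its translates, the translates of
the pair `g • Φ ⊂ Φ` crossed by a geodesic in the same direction are linearly ordered, and the
quasimorphism counts the maximal number of non-overlapping ones, in one direction minus the other.
Cutting a geodesic at an interior vertex destroys at most one translate of the pair, so comparing
the sides of a geodesic triangle with the paths through its median bounds the defect. The powers of
`g` give a chain of length `n - 1` from a vertex `a` to `g ^ n • a`, and the absence of inversions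
and self-osculations rules out chains in the opposite direction.

The geometry only involves the 2-skeleton. There, simple connectivity says that coverings are
trivial; applied to the covering formed by the reduced edge paths, it shows that the 1-skeleton is a
median graph. The Cayley complex of a right-angled Artin group has the required geometry because the
group acts on the total space of any covering. The action of the group preserves the labels of the
edges, and parallel edges have the same label; as the two labels at a corner of a square differ, and
no generator is equal to its inverse, the action is free of the forbidden configurations.
-/

/-! ### Edge paths and the quadrangle condition -/

/-- A square complex with the link conditions that the 2-skeleton of a nonpositively curved cube
complex satisfies: `IsSquare a b c d` says that `a, b, c, d` are the corners of a square in cyclic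
order, and `exists_cube` that three squares around a vertex that pairwise share an edge are
contained in the boundary of a 3-cube. -/
structure SquareComplex (V : Type*) where
  graph : SimpleGraph V
  IsSquare : V → V → V → V → Prop
  adj_of_isSquare : ∀ {a b c d}, IsSquare a b c d → graph.Adj a b
  ne_of_isSquare : ∀ {a b c d}, IsSquare a b c d → a ≠ c
  rotate_isSquare : ∀ {a b c d}, IsSquare a b c d → IsSquare b c d a
  flip_isSquare : ∀ {a b c d}, IsSquare a b c d → IsSquare a d c b
  eq_of_isSquare : ∀ {a b c d d'}, IsSquare a b c d → IsSquare a b c d' → d = d'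
  exists_cube : ∀ {v x y z p q r}, IsSquare v x p y → IsSquare v y q z → IsSquare v z r x →
    ∃ s, IsSquare x p s r ∧ IsSquare y q s p ∧ IsSquare z r s q

namespace SquareComplex

/-- A local system of sets on a square complex: the fibre over each vertex is a subset of a fixed
type `T`, and transport along an edge is undone by transport along the reversed edge and has no
holonomy around squares. Nothing is required of `transport x y` outside the fibre over `x`. -/
structure LocalSystem {V : Type*} (S : SquareComplex V) (T : Type*) where
  fibre : V → Set T
  transport : V → V → T → T
  mapsTo : ∀ {x y}, S.graph.Adj x y → Set.MapsTo (transport x y) (fibre x) (fibre y)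
  leftInvOn : ∀ {x y}, S.graph.Adj x y → Set.LeftInvOn (transport y x) (transport x y) (fibre x)
  eqOn : ∀ {a b c d}, S.IsSquare a b c d →
    Set.EqOn (transport b c ∘ transport a b) (transport d c ∘ transport a d) (fibre a)

/-- Simple connectivity, phrased as the triviality of all coverings: every point of a local system
extends to a global section. -/
class SimplyConnected {V : Type u} (S : SquareComplex V) : Prop where
  connected : S.graph.Connected
  exists_section : ∀ {T : Type u} (L : S.LocalSystem T) {v : V} {t : T}, t ∈ L.fibre v →
    ∃ φ : V → T, φ v = t ∧ ∀ x y, S.graph.Adj x y → φ y = L.transport x y (φ x)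

variable {V : Type u} {S : SquareComplex V}

namespace IsSquare

variable {a b c d : V}

theorem rotate (h : S.IsSquare a b c d) : S.IsSquare b c d a := S.rotate_isSquare h

theorem rotate₂ (h : S.IsSquare a b c d) : S.IsSquare c d a b := h.rotate.rotate

theorem rotate₃ (h : S.IsSquare a b c d) : S.IsSquare d a b c := h.rotate₂.rotate

theorem flip (h : S.IsSquare a b c d) : S.IsSquare a d c b := S.flip_isSquare h

theorem adj (h : S.IsSquare a b c d) : S.graph.Adj a b := S.adj_of_isSquare h

theorem ne (h : S.IsSquare a b c d) : a ≠ c := S.ne_of_isSquare h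

theorem eq_of_left {a' : V} (h : S.IsSquare a b c d) (h' : S.IsSquare a' b c d) : a = a' :=
  S.eq_of_isSquare h.rotate h'.rotate

end IsSquare

section Paths

variable (S) in
/-- Pushing an edge path across one square. Edge paths are lists of vertices, the last vertex of the
path being the head of the list. -/
inductive Push : List V → List V → Prop
  | cons {l l' : List V} (x : V) : Push l l' → Push (x :: l) (x :: l')
  | square {a b c d : V} (l : List V) :
      S.IsSquare a b c d → Push (c :: b :: a :: l) (c :: d :: a :: l)

variable (S) in
/-- Equivalence of edge paths under pushing across squares; unlike for homotopy of paths,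
backtracks are not removed. -/
def PushEquiv : List V → List V → Prop := Relation.ReflTransGen S.Push

theorem Push.symm {l l' : List V} (h : S.Push l l') : S.Push l' l := by
  induction h with
  | cons x _ ih => exact .cons x ih
  | square l h => exact .square l h.flip

theorem Push.length_eq {l l' : List V} (h : S.Push l l') : l.length = l'.length := by
  induction h with
  | cons _ _ ih => exact congrArg (· + 1) ih
  | square => rfl

theorem Push.head?_eq {l l' : List V} (h : S.Push l l') : l.head? = l'.head? := by
  cases h <;> rfl

namespace PushEquiv

protected theorem rfl {l : List V} : S.PushEquiv l l := .refl

theorem symm {l l' : List V} (h : S.PushEquiv l l') : S.PushEquiv l' l := by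
  induction h with
  | refl => exact .refl
  | tail _ h ih => exact .head h.symm ih

theorem trans {l l' l'' : List V} (h : S.PushEquiv l l') (h' : S.PushEquiv l' l'') :
    S.PushEquiv l l'' :=
  Relation.ReflTransGen.trans h h'

theorem cons {l l' : List V} (x : V) (h : S.PushEquiv l l') : S.PushEquiv (x :: l) (x :: l') :=
  Relation.ReflTransGen.lift (x :: ·) (fun _ _ h => Push.cons x h) _ _ h

theorem square {a b c d : V} (l : List V) (h : S.IsSquare a b c d) :
    S.PushEquiv (c :: b :: a :: l) (c :: d :: a :: l) :=
  .single (Push.square l h)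

theorem length_eq {l l' : List V} (h : S.PushEquiv l l') : l.length = l'.length := by
  induction h with
  | refl => rfl
  | tail _ h ih => exact ih.trans h.length_eq

theorem head?_eq {l l' : List V} (h : S.PushEquiv l l') : l.head? = l'.head? := by
  induction h with
  | refl => rfl
  | tail _ h ih => exact ih.trans h.head?_eq

theorem head_eq {x y : V} {l l' : List V} (h : S.PushEquiv (x :: l) (y :: l')) : x = y := by
  simpa using h.head?_eq

end PushEquiv

variable (S) in
/-- The paths `l` and `l'` to neighbours of `x` become equivalent, when extended to `x`, for an
obvious reason: they already are, or their last edges can be chosen to span a square with corner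
`x`. -/
inductive Joinable (x : V) (l l' : List V) : Prop
  | of_pushEquiv : S.PushEquiv l l' → Joinable x l l'
  | of_square {w y z : V} {m : List V} : S.IsSquare w y x z → S.PushEquiv l (y :: w :: m) →
      S.PushEquiv l' (z :: w :: m) → Joinable x l l'

/-- The inductive step of `PushEquiv.joinable`, where the 3-cube condition enters. -/
theorem Joinable.push {x a z d : V} {l m : List V} (h : S.Joinable x l (z :: a :: m))
    (hq : S.IsSquare a z x d)
    (ih : ∀ {l'}, S.PushEquiv (z :: a :: m) (z :: l') → S.Joinable z (a :: m) l') :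
    S.Joinable x l (d :: a :: m) := by
  cases h with
  | of_pushEquiv h => exact .of_square hq h .rfl
  | of_square hw hl hz =>
    obtain rfl := hz.head_eq
    cases ih hz with
    | of_pushEquiv h =>
      obtain rfl := h.head_eq
      obtain rfl := hw.flip.rotate₃.eq_of_left hq.rotate₃
      exact .of_pushEquiv (hl.trans (h.symm.cons _))
    | of_square ht ha hw' =>
      obtain rfl := ha.head_eq
      obtain rfl := hw'.head_eq
      obtain ⟨s, hs₁, hs₂, hs₃⟩ := S.exists_cube hw.rotate₃.flip ht.rotate₂ hq.rotate.flip
      exact .of_square hs₁.flip.rotate₂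
        ((hl.trans (hw'.cons _)).trans (.square _ hs₂.rotate.flip))
        ((ha.cons _).trans (.square _ hs₃.rotate₃))

theorem PushEquiv.joinable {x : V} {l l' : List V} (h : S.PushEquiv (x :: l) (x :: l')) :
    S.Joinable x l l' := by
  induction hn : l.length using Nat.strong_induction_on generalizing x l l' with
  | _ n ih =>
  subst hn
  generalize hR : x :: l' = R at h
  induction h generalizing l' with
  | refl =>
    obtain ⟨-, rfl⟩ := List.cons.inj hR
    exact .of_pushEquiv .rfl
  | @tail R R' hR' hpush ihR =>
    subst hR
    cases hpush with
    | @cons m _ _ hm =>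
      cases ihR rfl with
      | of_pushEquiv h => exact .of_pushEquiv (h.tail hm)
      | of_square hw h₁ h₂ => exact .of_square hw h₁ (.trans (.single hm.symm) h₂)
    | @square a z _ d m hq =>
      refine (ihR rfl).push hq fun h => ih _ ?_ h rfl
      have := PushEquiv.length_eq hR'
      simp only [List.length_cons] at this ⊢
      omega

theorem PushEquiv.of_cons_cons {x y : V} {l l' : List V}
    (h : S.PushEquiv (x :: y :: l) (x :: y :: l')) : S.PushEquiv (y :: l) (y :: l') := by
  cases h.joinable with
  | of_pushEquiv h => exact h
  | of_square hw h₁ h₂ => exact absurd (h₁.head_eq.symm.trans h₂.head_eq) hw.rotate.ne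

theorem PushEquiv.exists_isSquare {x y z : V} {l l' : List V}
    (h : S.PushEquiv (x :: y :: l) (x :: z :: l')) (hyz : y ≠ z) :
    ∃ w m, S.IsSquare w y x z ∧ S.PushEquiv (y :: l) (y :: w :: m) ∧
      S.PushEquiv (z :: l') (z :: w :: m) := by
  cases h.joinable with
  | of_pushEquiv h => exact absurd h.head_eq hyz
  | of_square hw h₁ h₂ =>
    obtain rfl := h₁.head_eq
    obtain rfl := h₂.head_eq
    exact ⟨_, _, hw, h₁, h₂⟩

/-- The path contains an edge followed by the reversed edge. -/
inductive HasBacktrack : List V → Prop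
  | here (x y : V) (l : List V) : HasBacktrack (x :: y :: x :: l)
  | cons {l : List V} (x : V) : HasBacktrack l → HasBacktrack (x :: l)

variable (S) in
/-- Reduced paths: no backtrack can be created by pushing across squares. -/
def Reduced (l : List V) : Prop := ∀ l', S.PushEquiv l l' → ¬ HasBacktrack l'

theorem Reduced.congr {l l' : List V} (h : S.Reduced l) (e : S.PushEquiv l l') : S.Reduced l' :=
  fun _ h' => h _ (e.trans h')

theorem Reduced.tail {x : V} {l : List V} (h : S.Reduced (x :: l)) : S.Reduced l :=
  fun _ h' hb => h _ (h'.cons x) (hb.cons x)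

theorem reduced_singleton (x : V) : S.Reduced [x] := by
  intro l h hb
  have hlen := h.length_eq
  cases hb with
  | here => simp at hlen
  | cons _ hb => cases hb <;> simp at hlen

theorem Reduced.not_pushEquiv_backtrack {x y : V} {l l' : List V} (h : S.Reduced (y :: x :: l)) :
    ¬ S.PushEquiv (x :: l) (x :: y :: l') :=
  fun h' => h _ (h'.cons y) (.here _ _ _)

theorem Reduced.exists_pushEquiv_of_not_reduced_cons {x y : V} {l : List V}
    (h : S.Reduced (x :: l)) (hy : ¬ S.Reduced (y :: x :: l)) :
    ∃ l', S.PushEquiv (x :: l) (x :: y :: l') := by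
  induction hn : l.length using Nat.strong_induction_on generalizing x y l with
  | _ n ih =>
  subst hn
  simp only [Reduced, not_forall, not_not] at hy
  obtain ⟨m, hm, hb⟩ := hy
  cases hb with
  | here u z m =>
    obtain rfl := hm.head_eq
    by_cases hxz : x = z
    · subst hxz
      exact ⟨m, hm.of_cons_cons⟩
    · obtain ⟨w, σ, hw, hx, hz⟩ := hm.exists_isSquare hxz
      obtain ⟨t, τ, ht, -, hwt⟩ := hz.exists_isSquare hw.ne.symm
      obtain rfl := ht.eq_of_left hw.rotate
      exact absurd (HasBacktrack.here _ _ _) (h _ (hx.trans (hwt.cons _)))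
  | @cons m u hb =>
    obtain rfl := hm.head_eq
    obtain ⟨z, m, rfl⟩ : ∃ z m', m = z :: m' := by cases hb <;> exact ⟨_, _, rfl⟩
    by_cases hxz : x = z
    · subst hxz
      exact absurd hb (h _ hm.of_cons_cons)
    · obtain ⟨w, σ, hw, hx, hz⟩ := hm.exists_isSquare hxz
      have hlt : σ.length < l.length := by
        have := hx.length_eq
        simp only [List.length_cons] at this
        omega
      obtain ⟨σ', hσ⟩ := ih _ hlt (h.congr hx).tail (fun h => h _ hz.symm hb) rfl
      exact ⟨z :: σ', (hx.trans (hσ.cons x)).trans (.square σ' hw.rotate₃)⟩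

end Paths

section PathClasses

variable (S) in
/-- Classes of edge paths under pushing across squares. -/
def pathSetoid : Setoid (List V) where
  r := S.PushEquiv
  iseqv := ⟨fun _ => .rfl, .symm, .trans⟩

variable (S) in
/-- The class of a path, as an element of the quotient. -/
def pathClass (l : List V) : Quotient S.pathSetoid := Quotient.mk _ l

theorem pathClass_eq_iff {l l' : List V} : S.pathClass l = S.pathClass l' ↔ S.PushEquiv l l' :=
  Quotient.eq

open Classical in
variable (S) in
/-- The effect of an edge `xy` on the class of a reduced path ending in `x`: if the path can be made
to end with the edge `yx`, then this edge is removed, otherwise `xy` is appended. -/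
noncomputable def pathTransport (x y : V) (c : Quotient S.pathSetoid) : Quotient S.pathSetoid :=
  if h : ∃ l, c = S.pathClass (x :: y :: l) then S.pathClass (y :: h.choose)
  else Quotient.lift (s := S.pathSetoid) (fun l => S.pathClass (y :: l))
    (fun _ _ h => pathClass_eq_iff.2 (PushEquiv.cons y h)) c

theorem pathTransport_of_pushEquiv {x y : V} {l l' : List V}
    (h : S.PushEquiv (x :: l) (x :: y :: l')) :
    S.pathTransport x y (S.pathClass (x :: l)) = S.pathClass (y :: l') := by
  have hex : ∃ m, S.pathClass (x :: l) = S.pathClass (x :: y :: m) := ⟨l', pathClass_eq_iff.2 h⟩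
  rw [pathTransport, dif_pos hex, pathClass_eq_iff]
  exact ((pathClass_eq_iff.1 hex.choose_spec).symm.trans h).of_cons_cons

theorem pathTransport_of_not_pushEquiv {x y : V} {l : List V}
    (h : ¬ ∃ l', S.PushEquiv (x :: l) (x :: y :: l')) :
    S.pathTransport x y (S.pathClass (x :: l)) = S.pathClass (y :: x :: l) := by
  simp only [← pathClass_eq_iff] at h
  rw [pathTransport, dif_neg h]
  rfl

theorem pathTransport_square_of_pushEquiv {a b c d : V} {l l' : List V} (hq : S.IsSquare a b c d)
    (hb : S.PushEquiv (a :: l) (a :: b :: l')) :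
    S.pathTransport b c (S.pathTransport a b (S.pathClass (a :: l))) =
      S.pathTransport d c (S.pathTransport a d (S.pathClass (a :: l))) := by
  rw [pathTransport_of_pushEquiv hb]
  by_cases hd : ∃ m, S.PushEquiv (a :: l) (a :: d :: m)
  · obtain ⟨m, hd⟩ := hd
    obtain ⟨w, σ, hw, hbw, hdw⟩ := (hb.symm.trans hd).exists_isSquare hq.rotate.ne
    obtain rfl := hw.eq_of_left hq.rotate₂.flip
    rw [pathTransport_of_pushEquiv hd, pathTransport_of_pushEquiv hbw,
      pathTransport_of_pushEquiv hdw]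
  · have hc : ¬ ∃ m, S.PushEquiv (b :: l') (b :: c :: m) := by
      rintro ⟨m, h⟩
      exact hd ⟨c :: m, (hb.trans (h.cons a)).trans (.square m hq.flip.rotate₂)⟩
    rw [pathTransport_of_not_pushEquiv hd, pathTransport_of_not_pushEquiv hc,
      pathTransport_of_pushEquiv ((hb.cons d).trans (.square l' hq.flip.rotate₃))]

theorem not_pushEquiv_of_isSquare {a b c d : V} {l : List V} (hq : S.IsSquare a b c d)
    (hd : ¬ ∃ l', S.PushEquiv (a :: l) (a :: d :: l')) :
    ¬ ∃ l', S.PushEquiv (b :: a :: l) (b :: c :: l') := by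
  rintro ⟨l', h⟩
  obtain ⟨w, m, hw, ha, -⟩ := h.exists_isSquare hq.ne
  obtain rfl := hw.eq_of_left hq.rotate₃
  exact hd ⟨m, ha⟩

theorem pathTransport_square {a b c d : V} (hq : S.IsSquare a b c d) (l : List V) :
    S.pathTransport b c (S.pathTransport a b (S.pathClass (a :: l))) =
      S.pathTransport d c (S.pathTransport a d (S.pathClass (a :: l))) := by
  by_cases hb : ∃ l', S.PushEquiv (a :: l) (a :: b :: l')
  · exact pathTransport_square_of_pushEquiv hq hb.choose_spec
  by_cases hd : ∃ l', S.PushEquiv (a :: l) (a :: d :: l')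
  · exact (pathTransport_square_of_pushEquiv hq.flip hd.choose_spec).symm
  rw [pathTransport_of_not_pushEquiv hb, pathTransport_of_not_pushEquiv hd,
    pathTransport_of_not_pushEquiv (not_pushEquiv_of_isSquare hq hd),
    pathTransport_of_not_pushEquiv (not_pushEquiv_of_isSquare hq.flip hb), pathClass_eq_iff]
  exact .square l hq

variable (S) in
/-- The local system of classes of reduced paths. Its sections show that reduced paths with the
same endpoints are equivalent. -/
noncomputable def pathSystem : S.LocalSystem (Quotient S.pathSetoid) where
  fibre x := {c | ∃ l, S.Reduced (x :: l) ∧ c = S.pathClass (x :: l)}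
  transport := S.pathTransport
  mapsTo := by
    rintro x y - _ ⟨l, hl, rfl⟩
    by_cases h : ∃ l', S.PushEquiv (x :: l) (x :: y :: l')
    · obtain ⟨l', h⟩ := h
      exact ⟨l', (hl.congr h).tail, pathTransport_of_pushEquiv h⟩
    · exact ⟨x :: l, by_contra fun hy => h (hl.exists_pushEquiv_of_not_reduced_cons hy),
        pathTransport_of_not_pushEquiv h⟩
  leftInvOn := by
    rintro x y - _ ⟨l, hl, rfl⟩
    by_cases h : ∃ l', S.PushEquiv (x :: l) (x :: y :: l')
    · obtain ⟨l', h⟩ := h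
      rw [pathTransport_of_pushEquiv h, pathTransport_of_not_pushEquiv, pathClass_eq_iff]
      · exact h.symm
      · rintro ⟨m, h'⟩
        exact (hl.congr h).not_pushEquiv_backtrack h'
    · rw [pathTransport_of_not_pushEquiv h, pathTransport_of_pushEquiv .rfl]
  eqOn := by
    rintro a b c d hq _ ⟨l, -, rfl⟩
    exact pathTransport_square hq l

end PathClasses

section Geodesics

variable (S) in
/-- `IsPath o l` says that `l` is an edge path starting in `o`; recall that paths are listed
backwards. -/
inductive IsPath (o : V) : List V → Prop
  | nil : IsPath o [o]
  | cons {x y : V} {l : List V} : IsPath o (x :: l) → S.graph.Adj x y → IsPath o (y :: x :: l)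

theorem Push.isPath {o : V} {l l' : List V} (h : S.Push l l') (p : S.IsPath o l) :
    S.IsPath o l' := by
  induction h with
  | cons x h ih =>
    cases p with
    | nil => cases h
    | cons p hadj =>
      cases h with
      | cons _ h => exact .cons (ih p) hadj
      | square _ h => exact .cons (ih p) hadj
  | square l h =>
    rcases p with _ | ⟨_ | ⟨p, -⟩, -⟩
    exact .cons (.cons p h.flip.adj) h.flip.rotate.adj

theorem PushEquiv.isPath {o : V} {l l' : List V} (h : S.PushEquiv l l') (p : S.IsPath o l) :
    S.IsPath o l' := by
  induction h with
  | refl => exact p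
  | tail _ h ih => exact h.isPath ih

theorem HasBacktrack.exists_isPath_length_lt {o : V} {l : List V} (h : HasBacktrack l)
    (p : S.IsPath o l) :
    ∃ l', S.IsPath o l' ∧ l'.head? = l.head? ∧ l'.length < l.length := by
  induction h with
  | here x y l =>
    rcases p with _ | ⟨_ | ⟨p, -⟩, -⟩
    exact ⟨_, p, rfl, by simp⟩
  | cons x h ih =>
    cases p with
    | nil => cases h
    | @cons y _ l p hadj =>
      obtain ⟨_ | ⟨z, m⟩, p', hhead, hlen⟩ := ih p
      · cases p'
      · obtain rfl : z = y := by simpa using hhead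
        exact ⟨_, p'.cons hadj, rfl, by simpa using hlen⟩

theorem exists_isPath_of_walk {o v : V} (w : S.graph.Walk v o) :
    ∃ l, S.IsPath o (v :: l) ∧ l.length = w.length := by
  induction w with
  | nil => exact ⟨[], .nil, rfl⟩
  | cons hadj w ih =>
    obtain ⟨l, p, hl⟩ := ih
    exact ⟨_, p.cons hadj.symm, congrArg (· + 1) hl⟩

variable [S.SimplyConnected]

/-- Both classes are the value at `v` of the section of `pathSystem` through the trivial path. -/
theorem Reduced.pushEquiv {o v : V} {l l' : List V} (p : S.IsPath o (v :: l))
    (p' : S.IsPath o (v :: l')) (h : S.Reduced (v :: l)) (h' : S.Reduced (v :: l')) :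
    S.PushEquiv (v :: l) (v :: l') := by
  obtain ⟨φ, hφ, hstep⟩ := SimplyConnected.exists_section S.pathSystem
    (v := o) ⟨[], reduced_singleton o, rfl⟩
  have eq_class : ∀ {m}, S.IsPath o m → ∀ {v l}, m = v :: l → S.Reduced m →
      φ v = S.pathClass m := by
    intro m p
    induction p with
    | nil =>
      rintro v l ⟨⟩ -
      exact hφ
    | @cons x y l _ hadj ih =>
      rintro v l ⟨⟩ hr
      rw [hstep x y hadj, ih rfl hr.tail]
      exact pathTransport_of_not_pushEquiv fun ⟨_, hb⟩ => hr.not_pushEquiv_backtrack hb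
  rw [← pathClass_eq_iff, ← eq_class p rfl h, eq_class p' rfl h']

theorem IsPath.dist_le {o v : V} {l : List V} (p : S.IsPath o (v :: l)) :
    S.graph.dist o v ≤ l.length := by
  generalize hm : v :: l = m at p
  induction p generalizing v l with
  | nil =>
    obtain ⟨rfl, rfl⟩ := List.cons.inj hm
    simp
  | @cons x y l _ hadj ih =>
    obtain ⟨rfl, rfl⟩ := List.cons.inj hm
    have htri := (SimplyConnected.connected (S := S)).dist_triangle (u := o) (v := x) (w := v)
    rw [SimpleGraph.dist_eq_one_iff_adj.2 hadj] at htri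
    exact htri.trans (Nat.succ_le_succ (ih rfl))

variable (S) in
theorem exists_isPath_length_eq_dist (o v : V) :
    ∃ l, S.IsPath o (v :: l) ∧ l.length = S.graph.dist o v := by
  obtain ⟨w, hw⟩ := (SimplyConnected.connected (S := S)).exists_walk_length_eq_dist v o
  obtain ⟨l, p, hl⟩ := exists_isPath_of_walk w
  exact ⟨l, p, by rw [hl, hw, SimpleGraph.dist_comm]⟩

theorem IsPath.reduced {o v : V} {l : List V} (p : S.IsPath o (v :: l))
    (h : l.length = S.graph.dist o v) : S.Reduced (v :: l) := by
  intro m hm hb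
  obtain ⟨_ | ⟨z, l'⟩, p', hhead, hlt⟩ := hb.exists_isPath_length_lt (hm.isPath p)
  · cases p'
  · obtain rfl : z = v := by simpa [← hm.head?_eq] using hhead
    have hle := p'.dist_le
    have hlen := hm.length_eq
    simp only [List.length_cons] at hlen hlt
    omega

theorem IsPath.length_eq_dist {o v : V} {l : List V} (p : S.IsPath o (v :: l))
    (h : S.Reduced (v :: l)) : l.length = S.graph.dist o v := by
  obtain ⟨l', p', hl'⟩ := S.exists_isPath_length_eq_dist o v
  simpa [hl'] using (Reduced.pushEquiv p p' h (p'.reduced hl')).length_eq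

variable (S) in
/-- The 1-skeleton is bipartite: pushing across squares preserves the length of a path. -/
theorem dist_ne_of_adj (o : V) {a b : V} (h : S.graph.Adj a b) :
    S.graph.dist o a ≠ S.graph.dist o b := by
  intro heq
  obtain ⟨l, p, hl⟩ := S.exists_isPath_length_eq_dist o a
  by_cases hr : S.Reduced (b :: a :: l)
  · have := (p.cons h).length_eq_dist hr
    simp only [List.length_cons] at this
    omega
  · obtain ⟨m, hm⟩ := (p.reduced hl).exists_pushEquiv_of_not_reduced_cons hr
    have hlen := hm.length_eq
    obtain _ | ⟨p', -⟩ := hm.isPath p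
    have hle := p'.dist_le
    simp only [List.length_cons] at hlen
    omega

variable (S) in
theorem dist_eq_dist_add_one_or_of_adj (o : V) {a b : V} (h : S.graph.Adj a b) :
    S.graph.dist o a = S.graph.dist o b + 1 ∨ S.graph.dist o b = S.graph.dist o a + 1 := by
  have hconn := SimplyConnected.connected (S := S)
  have hab := hconn.dist_triangle (u := o) (v := a) (w := b)
  have hba := hconn.dist_triangle (u := o) (v := b) (w := a)
  rw [SimpleGraph.dist_eq_one_iff_adj.2 h] at hab
  rw [SimpleGraph.dist_eq_one_iff_adj.2 h.symm] at hba
  have := S.dist_ne_of_adj o h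
  omega

variable (S) in
theorem dist_pos {x y : V} (h : x ≠ y) : 0 < S.graph.dist x y :=
  SimplyConnected.connected.pos_dist_of_ne h

variable (S) in
theorem exists_adj_dist_add_one_eq {o x : V} (h : o ≠ x) :
    ∃ y, S.graph.Adj y x ∧ S.graph.dist o y + 1 = S.graph.dist o x := by
  obtain ⟨l, p, hl⟩ := S.exists_isPath_length_eq_dist o x
  cases p with
  | nil => exact absurd rfl h
  | @cons y _ l p hadj =>
    refine ⟨y, hadj, ?_⟩
    have hle := p.dist_le
    have := S.dist_eq_dist_add_one_or_of_adj o hadj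
    simp only [List.length_cons] at hl
    omega

variable (S) in
/-- The quadrangle condition: connected bipartite graphs that satisfy it are modular, that is, every
three vertices have a median. -/
theorem exists_isSquare_of_adj_of_adj (o : V) {x y z : V} (hy : S.graph.Adj y x)
    (hz : S.graph.Adj z x) (hyz : y ≠ z) (dy : S.graph.dist o y + 1 = S.graph.dist o x)
    (dz : S.graph.dist o z + 1 = S.graph.dist o x) :
    ∃ w, S.IsSquare w y x z ∧ S.graph.dist o w + 1 = S.graph.dist o y := by
  obtain ⟨l, p, hl⟩ := S.exists_isPath_length_eq_dist o y
  obtain ⟨m, q, hm⟩ := S.exists_isPath_length_eq_dist o z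
  have hequiv := Reduced.pushEquiv (p.cons hy) (q.cons hz)
    ((p.cons hy).reduced (by simp only [List.length_cons]; omega))
    ((q.cons hz).reduced (by simp only [List.length_cons]; omega))
  obtain ⟨w, m', hw, hyw, -⟩ := hequiv.exists_isSquare hyz
  refine ⟨w, hw, ?_⟩
  have hlen := hyw.length_eq
  obtain _ | ⟨p', hadj⟩ := hyw.isPath p
  have hle := p'.dist_le
  have := S.dist_eq_dist_add_one_or_of_adj o hadj
  simp only [List.length_cons] at hlen
  omega

end Geodesics

end SquareComplex

/-! ### Halfspaces and medians -/

namespace SquareComplex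

variable {V : Type u} {S : SquareComplex V}

section Halfspaces

variable (S) in
/-- The halfspace of an edge `ab`: the vertices closer to `a` than to `b`. -/
def half (a b : V) : Set V := {z | S.graph.dist z a < S.graph.dist z b}

variable (S) in
/-- The halfspaces of all oriented edges. -/
def halfspaces : Set (Set V) := {Φ | ∃ a b, S.graph.Adj a b ∧ Φ = S.half a b}

variable (S) in
/-- Oriented parallelism of edges: `Parallel a b x y` says that the oriented edge `xy` is obtained
from `ab` by repeatedly moving to the opposite edge of a square. -/
inductive Parallel (a b : V) : V → V → Prop
  | refl : Parallel a b a b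
  | step {x y x' y' : V} : Parallel a b x y → S.IsSquare x y y' x' → Parallel a b x' y'

variable (S) in
/-- The geodesic interval between two vertices. -/
def interval (p q : V) : Set V := {m | S.graph.dist p m + S.graph.dist m q = S.graph.dist p q}

theorem mem_half {a b z : V} : z ∈ S.half a b ↔ S.graph.dist z a < S.graph.dist z b := .rfl

theorem mem_half' {a b z : V} : z ∈ S.half a b ↔ S.graph.dist a z < S.graph.dist b z := by
  rw [mem_half, S.graph.dist_comm (u := z), S.graph.dist_comm (u := z)]

theorem mem_interval {p q m : V} :
    m ∈ S.interval p q ↔ S.graph.dist p m + S.graph.dist m q = S.graph.dist p q := .rfl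

theorem interval_comm (p q : V) : S.interval p q = S.interval q p := by
  ext m
  rw [mem_interval, mem_interval, S.graph.dist_comm (u := p) (v := q),
    S.graph.dist_comm (u := p) (v := m), S.graph.dist_comm (u := m) (v := q), add_comm]

theorem left_mem_interval (p q : V) : p ∈ S.interval p q := by simp [mem_interval]

theorem right_mem_interval (p q : V) : q ∈ S.interval p q := by simp [mem_interval]

theorem right_notMem_half {a b : V} : b ∉ S.half a b := by simp [mem_half]

theorem half_mem_halfspaces {a b : V} (h : S.graph.Adj a b) : S.half a b ∈ S.halfspaces :=
  ⟨a, b, h, rfl⟩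

variable [S.SimplyConnected]

variable (S) in
theorem dist_triangle (x y z : V) :
    S.graph.dist x z ≤ S.graph.dist x y + S.graph.dist y z :=
  SimplyConnected.connected.dist_triangle

theorem left_mem_half {a b : V} (h : S.graph.Adj a b) : a ∈ S.half a b := by
  simpa [mem_half] using S.dist_pos h.ne

theorem compl_half {a b : V} (h : S.graph.Adj a b) : (S.half a b)ᶜ = S.half b a := by
  ext z
  have := S.dist_eq_dist_add_one_or_of_adj z h
  simp only [Set.mem_compl_iff, mem_half]
  omega

theorem compl_mem_halfspaces {Φ : Set V} (h : Φ ∈ S.halfspaces) : Φᶜ ∈ S.halfspaces := by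
  obtain ⟨a, b, h, rfl⟩ := h
  exact ⟨b, a, h.symm, compl_half h⟩

theorem nonempty_of_mem_halfspaces {Φ : Set V} (h : Φ ∈ S.halfspaces) : Φ.Nonempty := by
  obtain ⟨a, b, h, rfl⟩ := h
  exact ⟨a, left_mem_half h⟩

theorem IsSquare.half_subset {a b c d : V} (h : S.IsSquare a b c d) :
    S.half a b ⊆ S.half d c := by
  intro z hz
  have hab := S.dist_eq_dist_add_one_or_of_adj z h.adj
  have hbc := S.dist_eq_dist_add_one_or_of_adj z h.rotate.adj
  have hcd := S.dist_eq_dist_add_one_or_of_adj z h.rotate₂.adj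
  have hda := S.dist_eq_dist_add_one_or_of_adj z h.rotate₃.adj
  rw [mem_half] at hz ⊢
  by_contra hn
  obtain ⟨w, hw, hd⟩ := S.exists_isSquare_of_adj_of_adj z h.adj h.rotate.adj.symm h.ne
    (by omega) (by omega)
  obtain rfl := hw.eq_of_left h.rotate₃
  omega

theorem IsSquare.half_eq {a b c d : V} (h : S.IsSquare a b c d) : S.half a b = S.half d c :=
  h.half_subset.antisymm h.flip.rotate.half_subset

theorem Parallel.half_eq {a b x y : V} (h : S.Parallel a b x y) : S.half a b = S.half x y := by
  induction h with
  | refl => rfl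
  | step _ hq ih => exact ih.trans hq.half_eq

/-- Moving `xy` towards `ab` by the quadrangle condition at `y`, based at `b`. -/
theorem parallel_of_mem_half {a b x y : V} (hab : S.graph.Adj a b) (hxy : S.graph.Adj x y)
    (hx : x ∈ S.half a b) (hy : y ∉ S.half a b) : S.Parallel a b x y := by
  induction hn : S.graph.dist a x generalizing x y with
  | zero =>
    obtain rfl := SimplyConnected.connected.dist_eq_zero_iff.1 hn
    rw [mem_half', SimpleGraph.dist_eq_one_iff_adj.2 hxy, not_lt, Nat.le_one_iff_eq_zero_or_eq_one]
      at hy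
    have := S.dist_eq_dist_add_one_or_of_adj y hab
    rw [S.graph.dist_comm, SimpleGraph.dist_eq_one_iff_adj.2 hxy, S.graph.dist_comm] at this
    obtain rfl := SimplyConnected.connected.dist_eq_zero_iff.1 (show S.graph.dist b y = 0 by omega)
    exact .refl
  | succ n ih =>
    have hax : a ≠ x := by
      rintro rfl
      simp at hn
    obtain ⟨x', hx', hdx'⟩ := S.exists_adj_dist_add_one_eq hax
    have hxab := S.dist_eq_dist_add_one_or_of_adj x hab
    have hyab := S.dist_eq_dist_add_one_or_of_adj y hab
    have hx'ab := S.dist_eq_dist_add_one_or_of_adj x' hab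
    have haxy := S.dist_eq_dist_add_one_or_of_adj a hxy
    have hbxy := S.dist_eq_dist_add_one_or_of_adj b hxy
    have hbxx' := S.dist_eq_dist_add_one_or_of_adj b hx'
    simp only [mem_half', S.graph.dist_comm (u := x), S.graph.dist_comm (u := y),
      S.graph.dist_comm (u := x')] at *
    obtain ⟨w, hw, hbw⟩ := S.exists_isSquare_of_adj_of_adj b hx' hxy.symm (by rintro rfl; omega)
      (by omega) (by omega)
    have hawx' := S.dist_eq_dist_add_one_or_of_adj a hw.adj
    have hawy := S.dist_eq_dist_add_one_or_of_adj a hw.flip.adj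
    exact (ih hw.adj.symm (by omega) (by omega) (by omega)).step hw.rotate.flip

theorem eq_half_of_adj {Φ : Set V} (h : Φ ∈ S.halfspaces) {x y : V} (hxy : S.graph.Adj x y)
    (hx : x ∈ Φ) (hy : y ∉ Φ) : Φ = S.half x y := by
  obtain ⟨a, b, hab, rfl⟩ := h
  exact (parallel_of_mem_half hab hxy hx hy).half_eq

theorem parallel_of_half_eq {a b x y : V} (hab : S.graph.Adj a b) (hxy : S.graph.Adj x y)
    (h : S.half a b = S.half x y) : S.Parallel a b x y :=
  parallel_of_mem_half hab hxy (h ▸ left_mem_half hxy) (h ▸ right_notMem_half)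

end Halfspaces

section Medians

variable [S.SimplyConnected]

theorem interval_subset_of_mem_interval {p q m : V} (h : m ∈ S.interval p q) :
    S.interval p m ⊆ S.interval p q := by
  intro z hz
  have := S.dist_triangle p z q
  have := S.dist_triangle z m q
  rw [mem_interval] at *
  omega

theorem mem_interval_of_adj {p q x y : V} (h : x ∈ S.interval p q) (hyx : S.graph.Adj y x)
    (hd : S.graph.dist p y + 1 = S.graph.dist p x) : y ∈ S.interval p q := by
  refine interval_subset_of_mem_interval h ?_
  rw [mem_interval, SimpleGraph.dist_eq_one_iff_adj.2 hyx, hd]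

variable (S) in
theorem exists_adj_of_notMem_of_mem {Θ : Set V} {x y : V} (hx : x ∉ Θ) (hy : y ∈ Θ) :
    ∃ u v, S.graph.Adj u v ∧ u ∉ Θ ∧ v ∈ Θ ∧ v ∈ S.interval x y ∧ u ∈ S.interval x v := by
  induction hn : S.graph.dist x y generalizing y with
  | zero => exact absurd (SimplyConnected.connected.dist_eq_zero_iff.1 hn ▸ hy) hx
  | succ n ih =>
    have hxy : x ≠ y := ne_of_mem_of_not_mem hy hx |>.symm
    obtain ⟨z, hz, hd⟩ := S.exists_adj_dist_add_one_eq hxy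
    have hzI := mem_interval_of_adj (right_mem_interval x y) hz hd
    by_cases hzΘ : z ∈ Θ
    · obtain ⟨u, v, huv, hu, hv, hvI, huI⟩ := ih hzΘ (by omega)
      exact ⟨u, v, huv, hu, hv, interval_subset_of_mem_interval hzI hvI, huI⟩
    · exact ⟨z, y, hz, hzΘ, hy, right_mem_interval x y, hzI⟩

theorem interval_subset_of_mem_halfspaces {Φ : Set V} (h : Φ ∈ S.halfspaces) {p r : V}
    (hp : p ∈ Φ) (hr : r ∈ Φ) : S.interval p r ⊆ Φ := by
  intro m hm
  by_contra hmΦ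
  obtain ⟨u, v, huv, hu, hv, hvI, huI⟩ := S.exists_adj_of_notMem_of_mem hmΦ hr
  rw [eq_half_of_adj h huv.symm hv hu, mem_half] at hp
  have := S.dist_triangle p v r
  have := S.dist_triangle p m u
  rw [mem_interval] at *
  rw [SimpleGraph.dist_eq_one_iff_adj.2 huv] at huI
  omega

theorem dist_eq_add_of_inter_interval_subset {p q r : V}
    (h : S.interval p q ∩ S.interval p r ⊆ {p}) {s : V} (hs : s ∈ S.interval p r) :
    S.graph.dist q s = S.graph.dist q p + S.graph.dist p s := by
  induction hn : S.graph.dist p s using Nat.strong_induction_on generalizing s with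
  | _ n ih =>
  subst hn
  obtain rfl | hps := eq_or_ne p s
  · simp
  obtain ⟨s₁, hadj₁, hd₁⟩ := S.exists_adj_dist_add_one_eq hps
  have hs₁ := mem_interval_of_adj hs hadj₁ hd₁
  have ih₁ := ih _ (by omega) hs₁ rfl
  obtain hcloser | hfarther := S.dist_eq_dist_add_one_or_of_adj q hadj₁
  swap
  · omega
  exfalso
  obtain rfl | hps₁ := eq_or_ne p s₁
  · refine hps.symm (h ⟨?_, hs⟩)
    rw [interval_comm, mem_interval, S.graph.dist_comm (u := s), ← hd₁, SimpleGraph.dist_self]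
    exact hcloser.symm
  obtain ⟨s₂, hadj₂, hd₂⟩ := S.exists_adj_dist_add_one_eq hps₁
  have ih₂ := ih _ (by omega) (mem_interval_of_adj hs₁ hadj₂ hd₂) rfl
  obtain ⟨t, ht, hqt⟩ := S.exists_isSquare_of_adj_of_adj q hadj₁.symm hadj₂
    (by rintro rfl; omega) (by omega) (by omega)
  have hpts := S.dist_eq_dist_add_one_or_of_adj p ht.adj
  have hpts₂ := S.dist_eq_dist_add_one_or_of_adj p ht.flip.adj
  have iht := ih (S.graph.dist p t) (by omega) (mem_interval_of_adj hs ht.adj (by omega)) rfl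
  omega

variable (S) in
theorem exists_median (p q r : V) :
    ∃ m, m ∈ S.interval p q ∧ m ∈ S.interval p r ∧ m ∈ S.interval q r := by
  induction hn : S.graph.dist p q using Nat.strong_induction_on generalizing p with
  | _ n ih =>
  subst hn
  by_cases h : S.interval p q ∩ S.interval p r ⊆ {p}
  · refine ⟨p, left_mem_interval _ _, left_mem_interval _ _, ?_⟩
    exact (dist_eq_add_of_inter_interval_subset h (right_mem_interval p r)).symm
  · obtain ⟨m, ⟨hmq, hmr⟩, hmp : m ≠ p⟩ := Set.not_subset.1 h
    have hpos := S.dist_pos hmp.symm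
    obtain ⟨m', hm'q, hm'r, hm'⟩ := ih _ (by rw [mem_interval] at hmq; omega) m rfl
    rw [interval_comm] at hm'q hm'r hmq hmr
    exact ⟨m', interval_comm p q ▸ interval_subset_of_mem_interval hmq hm'q,
      interval_comm p r ▸ interval_subset_of_mem_interval hmr hm'r, hm'⟩

end Medians

section Pairs

variable (S) in
theorem exists_forall_dist_le {Φ Ψ : Set V} (hΦ : Φ.Nonempty) (hΨ : Ψ.Nonempty) :
    ∃ p ∈ Φ, ∃ q ∈ Ψ, ∀ p' ∈ Φ, ∀ q' ∈ Ψ, S.graph.dist p q ≤ S.graph.dist p' q' := by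
  obtain ⟨⟨p, q⟩, ⟨hp, hq⟩, hmin⟩ := exists_minimalFor_of_wellFoundedLT
    (fun x : V × V => x ∈ Φ ×ˢ Ψ) (fun x => S.graph.dist x.1 x.2) (hΦ.prod hΨ)
  refine ⟨p, hp, q, hq, fun p' hp' q' hq' => ?_⟩
  exact (le_total _ _).elim id (hmin (j := (p', q')) ⟨hp', hq'⟩)

variable [S.SimplyConnected]

variable (S) in
theorem finite_halfspaces_separating (x y : V) : {Θ ∈ S.halfspaces | x ∈ Θ ∧ y ∉ Θ}.Finite := by
  obtain ⟨p⟩ := (SimplyConnected.connected (S := S)).preconnected x y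
  induction p with
  | nil => exact Set.finite_empty.subset fun Θ h => h.2.2 h.2.1
  | @cons x x' y hadj _ ih =>
    refine (ih.insert (S.half x x')).subset ?_
    rintro Θ ⟨h, hx, hy⟩
    by_cases hx' : x' ∈ Θ
    · exact Or.inr ⟨h, hx', hy⟩
    · exact Or.inl (eq_half_of_adj h hadj hx hx')

theorem finite_halfspaces_between {Φ Ψ : Set V} (hΦ : Φ.Nonempty) (hΨ : Ψᶜ.Nonempty) :
    {Θ ∈ S.halfspaces | Φ ⊆ Θ ∧ Θ ⊆ Ψ}.Finite := by
  obtain ⟨x, hx⟩ := hΦ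
  obtain ⟨y, hy⟩ := hΨ
  exact (S.finite_halfspaces_separating x y).subset fun Θ h =>
    ⟨h.1, h.2.1 hx, fun hΘ => hy (h.2.2 hΘ)⟩

theorem exists_adj_of_inter_nonempty {Φ Ψ : Set V} (hΨ : Ψ ∈ S.halfspaces)
    (h : (Φ ∩ Ψ).Nonempty) (h' : (Φᶜ ∩ Ψ).Nonempty) :
    ∃ x y, S.graph.Adj x y ∧ x ∈ Φ ∧ y ∉ Φ ∧ x ∈ Ψ := by
  obtain ⟨p, hp, hpΨ⟩ := h
  obtain ⟨q, hq, hqΨ⟩ := h'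
  obtain ⟨u, v, huv, hu, hv, hvI, -⟩ := S.exists_adj_of_notMem_of_mem hq hp
  exact ⟨v, u, huv.symm, hv, hu, interval_subset_of_mem_halfspaces hΨ hqΨ hpΨ hvI⟩

/-- The hyperplane of `Φ` has dual edges on both sides of that of `Ψ`; somewhere on the way from
one to the other, two successive such edges span a square dual to both hyperplanes. -/
theorem exists_isSquare_of_transverse {Φ Ψ : Set V} (hΦ : Φ ∈ S.halfspaces)
    (hΨ : Ψ ∈ S.halfspaces) (h : CubeComplex.Transverse Φ Ψ) :
    ∃ x y y' x', S.IsSquare x y y' x' ∧ Φ = S.half x y ∧ Ψ = S.half x x' := by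
  simp only [CubeComplex.Transverse, CubeComplex.Nested, not_or,
    ← Set.inter_compl_nonempty_iff, compl_compl] at h
  obtain ⟨hΦΨ', hΦ'Ψ', hΦΨ, hΦ'Ψ⟩ := h
  obtain ⟨x, y, hxy, hx, hy, hxΨ⟩ := exists_adj_of_inter_nonempty hΨ hΦΨ hΦ'Ψ
  obtain ⟨x', y', hxy', hx', hy', hxΨ'⟩ :=
    exists_adj_of_inter_nonempty (compl_mem_halfspaces hΨ) hΦΨ' hΦ'Ψ'
  obtain rfl := eq_half_of_adj hΦ hxy hx hy
  have hpar := parallel_of_mem_half hxy hxy' hx' hy'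
  clear hxy' hx' hy'
  induction hpar with
  | refl => exact absurd hxΨ hxΨ'
  | @step s t s' t' hpar hq ih =>
    by_cases hs : s ∈ Ψ
    · exact ⟨s, t, t', s', hq, hpar.half_eq, eq_half_of_adj hΨ hq.flip.adj hs hxΨ'⟩
    · exact ih hs

theorem subset_of_forall_dist_le {Φ Θ : Set V} (hΦ : Φ ∈ S.halfspaces) (hΘ : Θ ∈ S.halfspaces)
    {p q : V} (hp : p ∈ Φ) (hmin : ∀ m ∈ Φ, S.graph.dist q p ≤ S.graph.dist q m) (hpΘ : p ∈ Θ)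
    (hqΘ : q ∉ Θ) : Φ ⊆ Θ := by
  intro r hr
  by_contra hrΘ
  obtain ⟨m, hmq, hmr, hqr⟩ := S.exists_median p q r
  have hmΦ := interval_subset_of_mem_halfspaces hΦ hp hr hmr
  have hmΘ : m ∈ Θᶜ := interval_subset_of_mem_halfspaces (compl_mem_halfspaces hΘ) hqΘ hrΘ hqr
  have hpos := S.dist_pos (ne_of_mem_of_not_mem hpΘ hmΘ)
  have hle := hmin m hmΦ
  rw [interval_comm, mem_interval, S.graph.dist_comm (u := m)] at hmq
  omega

/-- If the closest vertices of `Φ` and `Ψᶜ` were further than two edges apart, then the second edge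
of a geodesic between them would be dual to a hyperplane that separates `Φ` from `Ψᶜ`. -/
theorem exists_adj_adj_of_tight {Φ Ψ : Set V} (hΦ : Φ ∈ S.halfspaces) (hΨ : Ψ ∈ S.halfspaces)
    (h : Φ ⊂ Ψ) (ht : ¬ ∃ Θ ∈ S.halfspaces, Φ ⊂ Θ ∧ Θ ⊂ Ψ) :
    ∃ x y z, S.graph.Adj x y ∧ S.graph.Adj y z ∧ Φ = S.half x y ∧ Ψ = S.half y z := by
  obtain ⟨p, hp, q, hq : q ∉ Ψ, hmin⟩ := S.exists_forall_dist_le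
    (nonempty_of_mem_halfspaces hΦ) (nonempty_of_mem_halfspaces (compl_mem_halfspaces hΨ))
  obtain ⟨y, hyp, hy⟩ := S.exists_adj_dist_add_one_eq (ne_of_mem_of_not_mem (h.subset hp) hq).symm
  have hyΦ : y ∉ Φ := fun hyΦ => by
    have := hmin y hyΦ q hq
    rw [S.graph.dist_comm (u := p), S.graph.dist_comm (u := y)] at this
    omega
  have hΦ_eq := eq_half_of_adj hΦ hyp.symm hp hyΦ
  have hyΨ : y ∈ Ψ := by
    by_contra hyΨ
    exact h.ne (hΦ_eq.trans (eq_half_of_adj hΨ hyp.symm (h.subset hp) hyΨ).symm)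
  obtain ⟨z, hzy, hz⟩ := S.exists_adj_dist_add_one_eq (ne_of_mem_of_not_mem hyΨ hq).symm
  refine ⟨p, y, z, hyp.symm, hzy.symm, hΦ_eq, eq_half_of_adj hΨ hzy.symm hyΨ fun hzΨ => ?_⟩
  have hΘ := half_mem_halfspaces hzy.symm
  have hqΘ : q ∉ S.half y z := by
    rw [mem_half]
    omega
  have hpΘ : p ∈ S.half y z := by
    have htri := S.dist_triangle p z q
    rw [S.graph.dist_comm (u := z), S.graph.dist_comm (u := p) (v := q)] at htri
    rw [mem_half, SimpleGraph.dist_eq_one_iff_adj.2 hyp.symm]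
    omega
  have hΦΘ : Φ ⊆ S.half y z := subset_of_forall_dist_le hΦ hΘ hp
    (fun m hm => by simpa only [S.graph.dist_comm (u := q)] using hmin m hm q hq) hpΘ hqΘ
  have hΘΨ : S.half y z ⊆ Ψ := Set.compl_subset_compl.1 <|
    subset_of_forall_dist_le (compl_mem_halfspaces hΨ) (compl_mem_halfspaces hΘ) hq (hmin p hp)
      hqΘ (not_not_intro hpΘ)
  exact ht ⟨_, hΘ, ⟨hΦΘ, fun hΘΦ => hyΦ (hΘΦ (left_mem_half hzy.symm))⟩,
    ⟨hΘΨ, fun hΨΘ => right_notMem_half (hΨΘ hzΨ)⟩⟩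

end Pairs

end SquareComplex

/-! ### Tame actions -/

namespace CubeComplex.Nested

variable {V : Type*} {Φ Ψ : Set V} {x y z : V}

theorem subset_of_mem (h : Nested Φ Ψ) (hx : x ∈ Φ ∩ Ψ) (hy : y ∈ Ψ \ Φ) (hz : z ∈ Φᶜ ∩ Ψᶜ) :
    Φ ⊆ Ψ := by
  rcases h with h | h | h | h
  exacts [h, absurd (h hz.1) hz.2, absurd hx.2 (h hx.1), absurd hy.1 (h hy.2)]

theorem compl_subset_of_mem (h : Nested Φ Ψ) (hx : x ∈ Φ ∩ Ψ) (hy : y ∈ Φ \ Ψ) (hz : z ∈ Ψ \ Φ) :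
    Φᶜ ⊆ Ψ := by
  rcases h with h | h | h | h
  exacts [absurd (h hy.1) hy.2, h, absurd hx.2 (h hx.1), absurd hz.1 (h hz.2)]

theorem subset_compl_of_mem (h : Nested Φ Ψ) (hx : x ∈ Φ \ Ψ) (hy : y ∈ Ψ \ Φ)
    (hz : z ∈ Φᶜ ∩ Ψᶜ) : Φ ⊆ Ψᶜ := by
  rcases h with h | h | h | h
  exacts [absurd (h hx.1) hx.2, absurd (h hz.1) hz.2, h, absurd hy.1 (h hy.2)]

end CubeComplex.Nested

theorem smul_ssubset_smul_iff {V G : Type*} [Group G] [MulAction G V] {g : G} {A B : Set V} :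
    g • A ⊂ g • B ↔ A ⊂ B := by
  simp only [ssubset_iff_subset_not_subset, Set.smul_set_subset_smul_set_iff]

theorem antitone_pow_smul {V G : Type*} [Group G] [MulAction G V] {g : G} {Φ : Set V}
    (hg : g • Φ ⊆ Φ) : Antitone fun n : ℕ => g ^ n • Φ :=
  antitone_nat_of_succ_le fun n => by
    rw [pow_succ, mul_smul]
    exact Set.smul_set_mono hg

namespace SquareComplex

variable {V : Type u} {S : SquareComplex V} {G : Type*} [Group G] [MulAction G V]

variable (S G) in
/-- Actions by automorphisms of the 1-skeleton. -/
def IsAction : Prop := ∀ (g : G) {x y : V}, S.graph.Adj x y → S.graph.Adj (g • x) (g • y)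

variable (S G) in
/-- Actions such that no halfspace is inverted, is transverse to one of its translates, or is
tightly nested with a disjoint translate. -/
structure IsTameAction : Prop where
  isAction : S.IsAction G
  no_inversion : ∀ Φ ∈ S.halfspaces, ∀ h : G, h • Φ ≠ Φᶜ
  nested : ∀ Φ ∈ S.halfspaces, ∀ h : G, CubeComplex.Nested Φ (h • Φ)
  no_osculation : ∀ Φ ∈ S.halfspaces, ∀ h : G, Φ ⊂ (h • Φ)ᶜ →
    ∃ Θ ∈ S.halfspaces, Φ ⊂ Θ ∧ Θ ⊂ (h • Φ)ᶜ

variable [S.SimplyConnected]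

namespace IsAction

theorem dist_smul_le (H : S.IsAction G) (g : G) (x y : V) :
    S.graph.dist (g • x) (g • y) ≤ S.graph.dist x y := by
  obtain ⟨w, hw⟩ := (SimplyConnected.connected (S := S)).exists_walk_length_eq_dist x y
  let φ : S.graph →g S.graph := ⟨(g • ·), H g⟩
  rw [← hw, ← SimpleGraph.Walk.length_map φ w]
  exact SimpleGraph.dist_le (w.map φ)

theorem dist_smul (H : S.IsAction G) (g : G) (x y : V) :
    S.graph.dist (g • x) (g • y) = S.graph.dist x y :=
  (H.dist_smul_le g x y).antisymm (by simpa using H.dist_smul_le g⁻¹ (g • x) (g • y))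

theorem smul_half (H : S.IsAction G) (g : G) (a b : V) :
    g • S.half a b = S.half (g • a) (g • b) := by
  ext z
  rw [Set.mem_smul_set_iff_inv_smul_mem, mem_half, mem_half, ← H.dist_smul g (g⁻¹ • z) a,
    ← H.dist_smul g (g⁻¹ • z) b, smul_inv_smul]

theorem smul_mem_halfspaces (H : S.IsAction G) (g : G) {Φ : Set V} (h : Φ ∈ S.halfspaces) :
    g • Φ ∈ S.halfspaces := by
  obtain ⟨a, b, hab, rfl⟩ := h
  exact ⟨g • a, g • b, H g hab, H.smul_half g a b⟩

end IsAction

theorem eq_of_mem_half_of_adj {a u v : V} (huv : S.graph.Adj u v) (h : u ∈ S.half a v) :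
    u = a := by
  rwa [mem_half, SimpleGraph.dist_eq_one_iff_adj.2 huv, Nat.lt_one_iff,
    SimplyConnected.connected.dist_eq_zero_iff] at h

namespace IsTameAction

theorem nested_smul (H : S.IsTameAction G) {Φ : Set V} (h : Φ ∈ S.halfspaces) (g k : G) :
    CubeComplex.Nested (g • Φ) (k • Φ) := by
  have := H.nested (g • Φ) (H.isAction.smul_mem_halfspaces g h) (k * g⁻¹)
  rwa [smul_smul, inv_mul_cancel_right] at this

theorem smul_ne_compl_smul (H : S.IsTameAction G) {Φ : Set V} (h : Φ ∈ S.halfspaces) (g k : G) :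
    g • Φ ≠ (k • Φ)ᶜ := by
  have := H.no_inversion (k • Φ) (H.isAction.smul_mem_halfspaces k h) (g * k⁻¹)
  rwa [smul_smul, inv_mul_cancel_right] at this

theorem smul_eq_of_adj (H : S.IsTameAction G) {g : G} {u v : V} (hv : g • v = v)
    (huv : S.graph.Adj u v) : g • u = u := by
  by_contra hne
  have hguv : S.graph.Adj (g • u) v := by simpa only [hv] using H.isAction g huv
  have hn := H.nested _ (half_mem_halfspaces huv) g
  rw [H.isAction.smul_half, hv] at hn
  have hdisj := hn.subset_compl_of_mem (z := v)
    ⟨left_mem_half huv, fun h => hne (eq_of_mem_half_of_adj huv h).symm⟩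
    ⟨left_mem_half hguv, fun h => hne (eq_of_mem_half_of_adj hguv h)⟩
    ⟨right_notMem_half, right_notMem_half⟩
  have hssub : S.half u v ⊂ (g • S.half u v)ᶜ := by
    rw [H.isAction.smul_half, hv]
    exact ⟨hdisj, fun h => right_notMem_half (h right_notMem_half)⟩
  obtain ⟨Θ, hΘ, hlt, hgt⟩ := H.no_osculation _ (half_mem_halfspaces huv) g hssub
  rw [H.isAction.smul_half, hv] at hgt
  by_cases hvΘ : v ∈ Θ
  · refine hgt.ne ?_
    rw [compl_half hguv]
    exact eq_half_of_adj hΘ hguv.symm hvΘ fun h => hgt.subset h (left_mem_half hguv)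
  · exact hlt.ne (eq_half_of_adj hΘ huv (hlt.subset (left_mem_half huv)) hvΘ).symm

theorem smul_eq_of_smul_eq (H : S.IsTameAction G) {g : G} {v : V} (hv : g • v = v) (x : V) :
    g • x = x := by
  obtain ⟨p⟩ := (SimplyConnected.connected (S := S)).preconnected v x
  induction p with
  | nil => exact hv
  | cons hadj _ ih => exact ih (H.smul_eq_of_adj hv hadj.symm)

/-- For a vertex `x` of minimal displacement, the first edge of a geodesic from `x` to `g • x` is
shifted by `g`. -/
theorem exists_smul_half_ssubset (H : S.IsTameAction G) {g : G} (hg : ∃ x : V, g • x ≠ x) :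
    ∃ a b, S.graph.Adj a b ∧ g • S.half a b ⊂ S.half a b := by
  obtain ⟨x₀, hx₀⟩ := hg
  obtain ⟨x, -, hmin⟩ := exists_minimalFor_of_wellFoundedLT (fun _ : V => True)
    (fun x => S.graph.dist x (g • x)) ⟨x₀, trivial⟩
  have hgx : g • x ≠ x := fun hx => hx₀ (H.smul_eq_of_smul_eq hx x₀)
  obtain ⟨y, hyx, hd⟩ := S.exists_adj_dist_add_one_eq hgx
  have hgyx := H.isAction g hyx
  have hΦ := half_mem_halfspaces hyx.symm
  have hgΦ := half_mem_halfspaces hgyx.symm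
  have hgxΦ : g • x ∉ S.half x y := by
    rw [mem_half]
    omega
  have hygΦ : y ∈ S.half (g • x) (g • y) := by
    have hy := S.dist_eq_dist_add_one_or_of_adj y hgyx
    have hle : S.graph.dist x (g • x) ≤ S.graph.dist y (g • y) :=
      (le_total _ _).elim id (hmin (j := y) trivial)
    rw [S.graph.dist_comm, S.graph.dist_comm (u := g • x)] at hd
    rw [mem_half]
    omega
  have hxgΦ : x ∈ S.half (g • x) (g • y) := by
    by_contra hx
    refine H.no_inversion _ hΦ g ?_
    rw [H.isAction.smul_half, compl_half hyx.symm]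
    exact eq_half_of_adj hgΦ hyx hygΦ hx
  have hgyΦ : g • y ∉ S.half x y := by
    intro hgy
    refine H.no_inversion _ hΦ g ?_
    rw [H.isAction.smul_half, ← compl_half hgyx, compl_inj_iff]
    exact (eq_half_of_adj hΦ hgyx hgy hgxΦ).symm
  have hsub : S.half x y ⊆ S.half (g • x) (g • y) := by
    have hn := H.nested _ hΦ g
    rw [H.isAction.smul_half] at hn
    exact hn.subset_of_mem ⟨left_mem_half hyx.symm, hxgΦ⟩ ⟨hygΦ, right_notMem_half⟩
      ⟨hgyΦ, right_notMem_half⟩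
  refine ⟨y, x, hyx, ?_⟩
  rw [H.isAction.smul_half, ← compl_half hyx.symm, ← compl_half hgyx.symm]
  exact compl_lt_compl_iff_lt.2 ⟨hsub, fun h => right_notMem_half (h hygΦ)⟩

theorem exists_minimal_between {Φ Ψ : Set V} (hΦ : Φ.Nonempty) (hΨ : Ψᶜ.Nonempty)
    (h : ∃ Θ ∈ S.halfspaces, Φ ⊂ Θ ∧ Θ ⊂ Ψ) :
    ∃ Θ ∈ S.halfspaces, Φ ⊂ Θ ∧ Θ ⊂ Ψ ∧ ∀ Ξ ∈ S.halfspaces, Φ ⊂ Ξ → Ξ ⊆ Θ → Ξ = Θ := by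
  have hfin : {Θ | Θ ∈ S.halfspaces ∧ Φ ⊂ Θ ∧ Θ ⊂ Ψ}.Finite :=
    (finite_halfspaces_between hΦ hΨ).subset fun Θ h => ⟨h.1, h.2.1.subset, h.2.2.subset⟩
  obtain ⟨Θ, ⟨hΘ, hlt, hgt⟩, hmin⟩ := hfin.exists_minimal h
  exact ⟨Θ, hΘ, hlt, hgt, fun Ξ hΞ hΦΞ hΞΘ =>
    hΞΘ.antisymm (hmin ⟨hΞ, hΦΞ, hΞΘ.trans_ssubset hgt⟩ hΞΘ)⟩

theorem smul_eq_of_minimal (H : S.IsAction G) {Φ Θ : Set V} {k : G} (hk : k • Φ = Φ)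
    (hΘ : Θ ∈ S.halfspaces) (hΦΘ : Φ ⊂ Θ)
    (hmin : ∀ Ξ ∈ S.halfspaces, Φ ⊂ Ξ → Ξ ⊆ Θ → Ξ = Θ) (h : k • Θ ⊆ Θ ∨ Θ ⊆ k • Θ) :
    k • Θ = Θ := by
  have fixed : ∀ {k : G}, k • Φ = Φ → k • Θ ⊆ Θ → k • Θ = Θ := fun {k} hk hsub =>
    hmin _ (H.smul_mem_halfspaces k hΘ) (by rwa [← hk, smul_ssubset_smul_iff]) hsub
  obtain h | h := h
  · exact fixed hk h
  · refine (inv_smul_eq_iff.1 (fixed (inv_smul_eq_iff.2 hk.symm) ?_)).symm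
    rwa [Set.subset_smul_set_iff] at h

theorem smul_smul_eq_of_minimal (H : S.IsTameAction G) {h : G} {Φ Θ : Set V}
    (hΦ : Φ ∈ S.halfspaces) (hh : h • h • Φ = Φ) (hΘ : Θ ∈ S.halfspaces) (hΦΘ : Φ ⊂ Θ)
    (hΘΦ : Θ ⊂ (h • Φ)ᶜ) (hmin : ∀ Ξ ∈ S.halfspaces, Φ ⊂ Ξ → Ξ ⊆ Θ → Ξ = Θ) :
    Θ ⊆ (h • Θ)ᶜ ∧ h • h • Θ = Θ := by
  have hmul := H.isAction.smul_mem_halfspaces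
  have hΘΦ' : h • Θ ⊆ Φᶜ := by
    have := Set.smul_set_mono (a := h) hΘΦ.subset
    rwa [Set.smul_set_compl, hh] at this
  obtain ⟨p, hp⟩ := nonempty_of_mem_halfspaces hΦ
  have hpΘ : p ∈ Θ := hΦΘ.subset hp
  have hphΘ : p ∉ h • Θ := fun hmem => hΘΦ' hmem hp
  have hhpΘ : h • p ∉ Θ := fun hmem => hΘΦ.subset hmem (Set.smul_mem_smul_set hp)
  have hdisj : Θ ⊆ (h • Θ)ᶜ := by
    rcases H.nested Θ hΘ h with hc | hc | hc | hc
    · exact absurd (hc hpΘ) hphΘ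
    · have hsub : h⁻¹ • Θᶜ ⊆ Θ := Set.subset_smul_set_iff.1 hc
      have hΦ' : Φ ⊂ h⁻¹ • Θᶜ := by
        rw [← smul_ssubset_smul_iff (g := h), smul_inv_smul]
        exact compl_lt_compl_iff_lt.1 (by rwa [compl_compl])
      have := hmin _ (hmul _ (compl_mem_halfspaces hΘ)) hΦ' hsub
      exact absurd (inv_smul_eq_iff.1 this).symm (H.no_inversion Θ hΘ h)
    · exact hc
    · exact absurd (hc hhpΘ) (not_not_intro (Set.smul_mem_smul_set hpΘ))
  have hp₂ : p ∈ (h * h) • Θ := by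
    rw [mul_smul]
    exact Set.smul_set_mono (Set.smul_set_mono hΦΘ.subset) (hh.symm ▸ hp)
  have hhp₂ : h • p ∉ (h * h) • Θ := by rwa [mul_smul, Set.smul_mem_smul_set_iff]
  refine ⟨hdisj, ?_⟩
  rw [← mul_smul]
  refine smul_eq_of_minimal H.isAction (by rwa [mul_smul]) hΘ hΦΘ hmin ?_
  rcases H.nested Θ hΘ (h * h) with hc | hc | hc | hc
  · exact .inr hc
  · exact absurd (hc hhpΘ) hhp₂
  · exact absurd hp₂ (hc hpΘ)
  · exact .inl (Set.compl_subset_compl.1 hc)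

/-- Otherwise, choose `Φ` maximal. By the absence of osculations there is a minimal halfspace
strictly between `Φ` and `(h • Φ)ᶜ`, and it is exchanged with its image as well. -/
theorem smul_smul_ne_of_disjoint (H : S.IsTameAction G) {h : G} {Φ : Set V}
    (hΦ : Φ ∈ S.halfspaces) (hdisj : Φ ⊆ (h • Φ)ᶜ) : h • h • Φ ≠ Φ := by
  intro hh
  have nonempty_compl : ∀ {Φ : Set V}, Φ ∈ S.halfspaces → ((h • Φ)ᶜ)ᶜ.Nonempty := fun {Φ} hΦ => by
    rw [compl_compl]
    exact nonempty_of_mem_halfspaces (H.isAction.smul_mem_halfspaces h hΦ)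
  have hfin : {Θ | Θ ∈ S.halfspaces ∧ Φ ⊆ Θ ∧ Θ ⊆ (h • Θ)ᶜ ∧ h • h • Θ = Θ}.Finite := by
    refine (finite_halfspaces_between (S := S) (nonempty_of_mem_halfspaces hΦ)
      (nonempty_compl hΦ)).subset ?_
    rintro Θ ⟨hΘ, hΦΘ, hΘ', -⟩
    exact ⟨hΘ, hΦΘ, hΘ'.trans (Set.compl_subset_compl.2 (Set.smul_set_mono hΦΘ))⟩
  obtain ⟨Ψ, ⟨hΨ, hΦΨ, hΨdisj, hΨh⟩, hmax⟩ := hfin.exists_maximal ⟨Φ, hΦ, subset_rfl, hdisj, hh⟩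
  have hne : Ψ ≠ (h • Ψ)ᶜ := fun heq => H.no_inversion Ψ hΨ h (compl_eq_comm.1 heq.symm).symm
  obtain ⟨Θ, hΘ, hΨΘ, hΘΨ, hmin⟩ := exists_minimal_between (nonempty_of_mem_halfspaces hΨ)
    (nonempty_compl hΨ) (H.no_osculation Ψ hΨ h (hΨdisj.ssubset_of_ne hne))
  obtain ⟨hΘdisj, hΘh⟩ := H.smul_smul_eq_of_minimal hΨ hΨh hΘ hΨΘ hΘΨ hmin
  exact hΨΘ.not_subset (hmax ⟨hΘ, hΦΨ.trans hΨΘ.subset, hΘdisj, hΘh⟩ hΨΘ.subset)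

theorem not_subset_smul_smul (H : S.IsTameAction G) {Ψ : Set V} (hΨ : Ψ ∈ S.halfspaces) {k : G}
    (hdisj : Ψ ⊆ (k • Ψ)ᶜ) : ¬ Ψ ⊆ k • k • Ψ := by
  intro hsub
  set N := {Θ ∈ S.halfspaces | Ψ ⊆ Θ ∧ Θ ⊆ (k • Ψ)ᶜ}
  have hfin : N.Finite := finite_halfspaces_between (nonempty_of_mem_halfspaces hΨ)
    (by rw [compl_compl]; exact nonempty_of_mem_halfspaces (H.isAction.smul_mem_halfspaces k hΨ))
  have hmaps : Set.MapsTo (fun Θ : Set V => k • k • Θ) N N := by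
    rintro Θ ⟨hΘ, hΨΘ, hΘΨ⟩
    refine ⟨H.isAction.smul_mem_halfspaces _ (H.isAction.smul_mem_halfspaces _ hΘ),
      hsub.trans (Set.smul_set_mono (Set.smul_set_mono hΨΘ)), ?_⟩
    have := Set.smul_set_mono (a := k) (Set.smul_set_mono (a := k) hΘΨ)
    rw [Set.smul_set_compl, Set.smul_set_compl] at this
    exact this.trans (Set.compl_subset_compl.2 (Set.smul_set_mono hsub))
  have hinj : Set.InjOn (fun Θ : Set V => k • k • Θ) N :=
    ((MulAction.injective k).comp (MulAction.injective k)).injOn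
  obtain ⟨Θ, ⟨-, hΨΘ, -⟩, hΘ⟩ : ∃ Θ ∈ N, k • k • Θ = Ψ :=
    ((hfin.injOn_iff_bijOn_of_mapsTo hmaps).1 hinj).surjOn ⟨hΨ, subset_rfl, hdisj⟩
  refine H.smul_smul_ne_of_disjoint hΨ hdisj (Set.Subset.antisymm ?_ hsub)
  exact (Set.smul_set_mono (Set.smul_set_mono hΨΘ)).trans hΘ.subset

theorem disjoint_smul_smul (H : S.IsTameAction G) {Ψ : Set V} (hΨ : Ψ ∈ S.halfspaces)
    {k : G} (hdisj : Ψ ⊆ (k • Ψ)ᶜ) : Ψ ⊆ (k • k • Ψ)ᶜ := by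
  have hdisj' : Ψ ⊆ (k⁻¹ • Ψ)ᶜ := by
    rw [← Set.smul_set_compl, Set.subset_smul_set_iff, inv_inv]
    exact Set.subset_compl_comm.1 hdisj
  have hn := H.nested Ψ hΨ (k * k)
  rw [mul_smul] at hn
  rcases hn with h | h | h | h
  · exact absurd h (H.not_subset_smul_smul hΨ hdisj)
  · obtain ⟨q, hq⟩ := nonempty_of_mem_halfspaces (H.isAction.smul_mem_halfspaces k hΨ)
    have := Set.smul_set_mono (a := k) hdisj
    rw [Set.smul_set_compl] at this
    exact absurd (h fun hqΨ => hdisj hqΨ hq) (this hq)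
  · exact h
  · refine absurd ?_ (H.not_subset_smul_smul hΨ hdisj')
    rw [Set.subset_smul_set_iff, Set.subset_smul_set_iff, inv_inv]
    exact Set.compl_subset_compl.1 h

theorem between_of_mem_of_notMem (H : S.IsTameAction G) {g k : G} {a b : V}
    (hab : S.graph.Adj a b) (hg : g • S.half a b ⊆ S.half a b) (ha : a ∈ k • S.half a b)
    (hga : g • a ∉ k • S.half a b) :
    (S.half a b)ᶜ ⊆ k • S.half a b ∧ k • S.half a b ⊆ (g • S.half a b)ᶜ := by
  have hΦ := half_mem_halfspaces hab
  have hkΦ := H.isAction.smul_mem_halfspaces k hΦ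
  have hgab := H.isAction g hab
  have hgaΦ : g • a ∈ g • S.half a b := Set.smul_mem_smul_set (left_mem_half hab)
  have hgbΦ : g • b ∉ g • S.half a b := by
    rw [Set.smul_mem_smul_set_iff]
    exact right_notMem_half
  have hb : b ∈ k • S.half a b := by
    by_contra hb
    rw [eq_half_of_adj hkΦ hab ha hb] at hga
    exact hga (hg hgaΦ)
  have hgb : g • b ∉ k • S.half a b := by
    intro hgb
    refine H.smul_ne_compl_smul hΦ k g ?_
    rw [H.isAction.smul_half g, compl_half hgab]
    exact eq_half_of_adj hkΦ hgab.symm hgb hga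
  exact ⟨(H.nested _ hΦ k).compl_subset_of_mem ⟨left_mem_half hab, ha⟩ ⟨hg hgaΦ, hga⟩
      ⟨hb, right_notMem_half⟩,
    (H.nested_smul hΦ k g).subset_compl_of_mem ⟨hb, fun hmem => right_notMem_half (hg hmem)⟩
      ⟨hgaΦ, hga⟩ ⟨hgb, hgbΦ⟩⟩

theorem smul_smul_subset_of_between (H : S.IsTameAction G) {Φ : Set V} (hΦ : Φ ∈ S.halfspaces)
    {g k : G} (hΦk : Φᶜ ⊆ k • Φ) (hkΦ : k • Φ ⊆ (g • Φ)ᶜ) : k • g • Φ ⊆ Φ := by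
  have hdisj := H.disjoint_smul_smul (compl_mem_halfspaces hΦ)
    (show Φᶜ ⊆ (k • Φᶜ)ᶜ by rwa [Set.smul_set_compl, compl_compl])
  refine (Set.smul_set_mono (Set.subset_compl_comm.1 hkΦ)).trans ?_
  rw [← Set.smul_set_compl]
  simpa only [Set.smul_set_compl, compl_compl] using Set.subset_compl_comm.1 hdisj

/-- No translate of the pair `g • Φ ⊂ Φ` is crossed in the wrong direction by the axis of `g`. -/
theorem pow_smul_mem (H : S.IsTameAction G) {g h : G} {a b : V} (hab : S.graph.Adj a b)
    (hg : g • S.half a b ⊆ S.half a b) {n : ℕ} (ha : a ∈ h • g • S.half a b) :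
    g ^ n • a ∈ h • S.half a b := by
  by_contra hga
  have hΦ := half_mem_halfspaces hab
  have hanti := antitone_pow_smul hg
  set Φ := S.half a b
  have hpow : ∀ j : ℕ, g ^ j • Φ ⊆ Φ := fun j => by simpa using hanti j.zero_le
  have hsub : h • g • Φ ⊆ h • Φ := Set.smul_set_mono hg
  obtain ⟨hΦh, hhΦ⟩ := H.between_of_mem_of_notMem hab (hpow n) (hsub ha) hga
  obtain ⟨hΦhg, -⟩ := H.between_of_mem_of_notMem (k := h * g) hab (hpow n)
    (by rwa [mul_smul]) (by rw [mul_smul]; exact fun hmem => hga (hsub hmem))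
  obtain ⟨i, hi, hi'⟩ := Nat.exists_not_and_succ_of_not_zero_of_exists
    (p := fun j => ¬ (g ^ j • Φ)ᶜ ⊆ h • Φ) (by simpa using hΦh)
    ⟨n, fun hmem => H.smul_ne_compl_smul hΦ h (g ^ n) (hhΦ.antisymm hmem)⟩
  have hhi : h • Φ ⊆ (g ^ (i + 1) • Φ)ᶜ := by
    obtain ⟨p, hpΦ, hph⟩ := Set.not_subset.1 hi'
    obtain ⟨q, hq : q ∉ Φ⟩ := nonempty_of_mem_halfspaces (compl_mem_halfspaces hΦ)
    obtain ⟨r, hr⟩ :=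
      nonempty_of_mem_halfspaces (H.isAction.smul_mem_halfspaces (g ^ (n + (i + 1))) hΦ)
    exact (H.nested_smul hΦ h (g ^ (i + 1))).subset_compl_of_mem
      ⟨hΦh hq, fun hmem => hq (hpow _ hmem)⟩
      ⟨hanti (Nat.le_add_left _ _) hr, fun hmem => hhΦ hmem (hanti (Nat.le_add_right _ _) hr)⟩
      ⟨hph, hpΦ⟩
  have hbetween : ((g ^ i)⁻¹ * h) • g • Φ ⊆ Φ := by
    refine H.smul_smul_subset_of_between hΦ ?_ ?_
    · rw [mul_smul, Set.subset_smul_set_iff, inv_inv, Set.smul_set_compl]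
      exact not_not.1 hi
    · rw [mul_smul, ← Set.subset_smul_set_iff, Set.smul_set_compl, smul_smul, ← pow_succ]
      exact hhi
  rw [mul_smul, ← Set.subset_smul_set_iff] at hbetween
  obtain ⟨q, hq⟩ := nonempty_of_mem_halfspaces (compl_mem_halfspaces hΦ)
  rw [mul_smul] at hΦhg
  exact hq (hpow i (hbetween (hΦhg hq)))

end IsTameAction

end SquareComplex

/-! ### Chains of translates -/

namespace SquareComplex

variable {V : Type u} {G : Type*} [Group G] [MulAction G V] {g : G} {Φ : Set V}
  {x y m : V} {l : List G}

/-- A list of translates of the pair `g • Φ ⊆ Φ` that do not overlap and are entered one after the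
other on the way from `x` to `y`, each translate being recorded by an element of the group. -/
structure IsChain (g : G) (Φ : Set V) (x y : V) (l : List G) : Prop where
  pairwise : l.Pairwise fun h k => k • Φ ⊆ h • g • Φ
  notMem : ∀ h ∈ l, x ∉ h • Φ
  mem : ∀ h ∈ l, y ∈ h • g • Φ

/-- The maximal length of a chain from `x` to `y`; it is only meaningful if this length is bounded.
-/
noncomputable def chainNumber (g : G) (Φ : Set V) (x y : V) : ℕ :=
  sSup {n | ∃ l, IsChain g Φ x y l ∧ l.length = n}

/-- The antisymmetric counting function of the pair `g • Φ ⊆ Φ`, evaluated on a pair of vertices. -/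
noncomputable def chainCount (g : G) (Φ : Set V) (x y : V) : ℤ :=
  chainNumber g Φ x y - chainNumber g Φ y x

theorem isChain_nil : IsChain g Φ x y [] := ⟨.nil, by simp, by simp⟩

theorem IsChain.smul (t : G) (h : IsChain g Φ x y l) :
    IsChain g Φ (t • x) (t • y) (l.map (t * ·)) where
  pairwise := List.pairwise_map.2 <| h.pairwise.imp fun hkh => by
    simpa only [mul_smul] using Set.smul_set_mono hkh
  notMem := List.forall_mem_map.2 fun k hk => by
    simpa only [mul_smul, Set.smul_mem_smul_set_iff] using h.notMem k hk
  mem := List.forall_mem_map.2 fun k hk => by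
    simpa only [mul_smul, Set.smul_mem_smul_set_iff] using h.mem k hk

theorem chainNumber_smul (t : G) (x y : V) :
    chainNumber g Φ (t • x) (t • y) = chainNumber g Φ x y := by
  refine congrArg sSup (Set.ext fun n => ⟨?_, ?_⟩)
  · rintro ⟨l, hl, rfl⟩
    exact ⟨_, by simpa only [inv_smul_smul] using hl.smul t⁻¹, List.length_map _⟩
  · rintro ⟨l, hl, rfl⟩
    exact ⟨_, hl.smul t, List.length_map _⟩

theorem chainCount_smul (t : G) (x y : V) :
    chainCount g Φ (t • x) (t • y) = chainCount g Φ x y := by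
  simp only [chainCount, chainNumber_smul]

theorem neg_chainCount (x y : V) : -chainCount g Φ x y = chainCount g Φ y x := neg_sub _ _

theorem IsChain.nodup_map_smul (h : IsChain g Φ x y l) (hg : g • Φ ⊂ Φ) :
    (l.map (· • Φ)).Nodup :=
  List.pairwise_map.2 <| h.pairwise.imp fun hkh =>
    (hkh.trans_ssubset (smul_ssubset_smul_iff.2 hg)).ne'

namespace IsTameAction

variable {S : SquareComplex V} [S.SimplyConnected]

theorem bddAbove_length_isChain (H : S.IsTameAction G) (hΦ : Φ ∈ S.halfspaces) (hg : g • Φ ⊂ Φ)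
    (x y : V) : BddAbove {n | ∃ l, IsChain g Φ x y l ∧ l.length = n} := by
  classical
  refine ⟨{Θ ∈ S.halfspaces | y ∈ Θ ∧ x ∉ Θ}.ncard, ?_⟩
  rintro _ ⟨l, hl, rfl⟩
  rw [← List.length_map (· • Φ), ← List.toFinset_card_of_nodup (hl.nodup_map_smul hg),
    ← Set.ncard_coe_finset]
  refine Set.ncard_le_ncard (fun Θ hΘ => ?_) (S.finite_halfspaces_separating y x)
  obtain ⟨h, hh, rfl⟩ := List.mem_map.1 (List.mem_toFinset.1 hΘ)
  exact ⟨H.isAction.smul_mem_halfspaces h hΦ, Set.smul_set_mono hg.subset (hl.mem h hh),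
    hl.notMem h hh⟩

theorem length_le_chainNumber (H : S.IsTameAction G) (hΦ : Φ ∈ S.halfspaces) (hg : g • Φ ⊂ Φ)
    (hl : IsChain g Φ x y l) : l.length ≤ chainNumber g Φ x y :=
  le_csSup (H.bddAbove_length_isChain hΦ hg x y) ⟨l, hl, rfl⟩

theorem exists_isChain_length_eq (H : S.IsTameAction G) (hΦ : Φ ∈ S.halfspaces) (hg : g • Φ ⊂ Φ)
    (x y : V) : ∃ l, IsChain g Φ x y l ∧ l.length = chainNumber g Φ x y :=
  Nat.sSup_mem (s := {n | ∃ l, IsChain g Φ x y l ∧ l.length = n}) ⟨0, [], isChain_nil, rfl⟩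
    (H.bddAbove_length_isChain hΦ hg x y)

theorem smul_subset_of_mem_interval (H : S.IsTameAction G) (hΦ : Φ ∈ S.halfspaces)
    (hm : m ∈ S.interval x y) {h k : G} (hxh : x ∉ h • Φ) (hmh : m ∈ h • Φ) (hmk : m ∉ k • Φ)
    (hyk : y ∈ k • Φ) : k • Φ ⊆ h • Φ := by
  have hhΦ := H.isAction.smul_mem_halfspaces h hΦ
  have hkΦ := H.isAction.smul_mem_halfspaces k hΦ
  have hyh : y ∈ h • Φ := by
    by_contra hyh
    exact interval_subset_of_mem_halfspaces (compl_mem_halfspaces hhΦ) hxh hyh hm hmh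
  have hxk : x ∉ k • Φ := fun hxk => hmk (interval_subset_of_mem_halfspaces hkΦ hxk hyk hm)
  exact (H.nested_smul hΦ k h).subset_of_mem ⟨hyk, hyh⟩ ⟨hmh, hmk⟩ ⟨hxk, hxh⟩

theorem isChain_append (H : S.IsTameAction G) (hΦ : Φ ∈ S.halfspaces) (hg : g • Φ ⊆ Φ)
    (hm : m ∈ S.interval x y) {l₁ l₂ : List G} (h₁ : IsChain g Φ x m l₁)
    (h₂ : IsChain g Φ m y l₂) : IsChain g Φ x y (l₁ ++ l₂) := by
  have hsub (h : G) : h • g • Φ ⊆ h • Φ := Set.smul_set_mono hg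
  have hgΦ (h : G) : h • g • Φ ∈ S.halfspaces :=
    H.isAction.smul_mem_halfspaces h (H.isAction.smul_mem_halfspaces g hΦ)
  refine ⟨List.pairwise_append.2 ⟨h₁.pairwise, h₂.pairwise, fun h hh k hk => ?_⟩,
    List.forall_mem_append.2 ⟨h₁.notMem, fun h hh hx => h₂.notMem h hh ?_⟩,
    List.forall_mem_append.2 ⟨fun h hh => ?_, h₂.mem⟩⟩
  · have := H.smul_subset_of_mem_interval (h := h * g) (k := k) hΦ hm
    simp only [mul_smul] at this
    exact this (fun hx => h₁.notMem h hh (hsub h hx)) (h₁.mem h hh) (h₂.notMem k hk)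
      (hsub k (h₂.mem k hk))
  · exact interval_subset_of_mem_halfspaces (H.isAction.smul_mem_halfspaces h hΦ) hx
      (hsub h (h₂.mem h hh)) hm
  · by_contra hy
    exact interval_subset_of_mem_halfspaces (compl_mem_halfspaces (hgΦ h))
      (fun hx => h₁.notMem h hh (hsub h hx)) hy hm (h₁.mem h hh)

end IsTameAction

theorem IsChain.exists_split (hl : IsChain g Φ x y l) (m : V) :
    ∃ l₁ l₂, IsChain g Φ x m l₁ ∧ IsChain g Φ m y l₂ ∧ l.length ≤ l₁.length + l₂.length + 1 := by
  classical
  set l₁ := l.takeWhile (m ∈ · • g • Φ)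
  have hl₁ : ∀ h ∈ l₁, m ∈ h • g • Φ := fun h hh => by simpa using List.mem_takeWhile_imp hh
  have happ : l₁ ++ l.dropWhile (m ∈ · • g • Φ) = l := List.takeWhile_append_dropWhile
  rcases hl₂ : l.dropWhile (m ∈ · • g • Φ) with _ | ⟨h, l₂⟩
  · rw [hl₂, List.append_nil] at happ
    exact ⟨l₁, [], ⟨happ ▸ hl.pairwise, happ ▸ hl.notMem, hl₁⟩, isChain_nil, by simp [happ]⟩
  · have hmh : m ∉ h • g • Φ := by
      simpa [hl₂] using List.head_dropWhile_not (p := (m ∈ · • g • Φ)) (l := l) (by simp [hl₂])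
    rw [hl₂] at happ
    have hp := happ ▸ hl.pairwise
    have hx := happ ▸ hl.notMem
    have hy := happ ▸ hl.mem
    rw [List.pairwise_append, List.pairwise_cons] at hp
    rw [List.forall_mem_append, List.forall_mem_cons] at hx hy
    refine ⟨l₁, l₂, ⟨hp.1, hx.1, hl₁⟩, ⟨hp.2.1.2, fun k hk hmk => hmh (hp.2.1.1 k hk hmk), hy.2.2⟩,
      ?_⟩
    rw [← happ, List.length_append, List.length_cons, add_assoc]

namespace IsTameAction

variable {S : SquareComplex V} [S.SimplyConnected]

theorem chainNumber_add_le (H : S.IsTameAction G) (hΦ : Φ ∈ S.halfspaces) (hg : g • Φ ⊂ Φ)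
    (hm : m ∈ S.interval x y) :
    chainNumber g Φ x m + chainNumber g Φ m y ≤ chainNumber g Φ x y := by
  obtain ⟨l₁, h₁, hl₁⟩ := H.exists_isChain_length_eq hΦ hg x m
  obtain ⟨l₂, h₂, hl₂⟩ := H.exists_isChain_length_eq hΦ hg m y
  rw [← hl₁, ← hl₂, ← List.length_append]
  exact H.length_le_chainNumber hΦ hg (H.isChain_append hΦ hg.subset hm h₁ h₂)

theorem chainNumber_le_add_add_one (H : S.IsTameAction G) (hΦ : Φ ∈ S.halfspaces)
    (hg : g • Φ ⊂ Φ) (x m y : V) :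
    chainNumber g Φ x y ≤ chainNumber g Φ x m + chainNumber g Φ m y + 1 := by
  obtain ⟨l, h, hl⟩ := H.exists_isChain_length_eq hΦ hg x y
  obtain ⟨l₁, l₂, h₁, h₂, hle⟩ := h.exists_split m
  have := H.length_le_chainNumber hΦ hg h₁
  have := H.length_le_chainNumber hΦ hg h₂
  omega

theorem abs_chainCount_sub_le (H : S.IsTameAction G) (hΦ : Φ ∈ S.halfspaces) (hg : g • Φ ⊂ Φ)
    (hm : m ∈ S.interval x y) :
    |chainCount g Φ x y - (chainCount g Φ x m + chainCount g Φ m y)| ≤ 1 := by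
  have := H.chainNumber_add_le hΦ hg hm
  have := H.chainNumber_le_add_add_one hΦ hg x m y
  have := H.chainNumber_add_le hΦ hg (S.interval_comm x y ▸ hm)
  have := H.chainNumber_le_add_add_one hΦ hg y m x
  rw [abs_le, chainCount, chainCount, chainCount]
  omega

/-- Compare the three sides with the paths through the median of the three vertices. -/
theorem abs_chainCount_triangle_le (H : S.IsTameAction G) (hΦ : Φ ∈ S.halfspaces)
    (hg : g • Φ ⊂ Φ) (x y z : V) :
    |chainCount g Φ x z - chainCount g Φ x y - chainCount g Φ y z| ≤ 3 := by
  obtain ⟨m, hxy, hxz, hyz⟩ := S.exists_median x y z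
  have hxy := abs_le.1 (H.abs_chainCount_sub_le hΦ hg hxy)
  have hxz := abs_le.1 (H.abs_chainCount_sub_le hΦ hg hxz)
  have hyz := abs_le.1 (H.abs_chainCount_sub_le hΦ hg hyz)
  have := neg_chainCount (g := g) (Φ := Φ) m y
  rw [abs_le]
  omega

end IsTameAction

end SquareComplex

/-! ### Quasimorphisms and stable commutator length -/

section StableCommutatorLength

variable {G : Type*} [Group G] {g h : G}

theorem inv_mem_commutatorSet (hg : g ∈ commutatorSet G) : g⁻¹ ∈ commutatorSet G := by
  obtain ⟨a, b, rfl⟩ := hg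
  exact ⟨b, a, (commutatorElement_inv a b).symm⟩

theorem exists_list_length_eq_commutatorLength (hg : g ∈ commutator G) :
    ∃ l : List G, l.length = commutatorLength g ∧ (∀ x ∈ l, x ∈ commutatorSet G) ∧ l.prod = g := by
  rw [commutator_eq_closure, ← Subgroup.mem_toSubmonoid, Subgroup.closure_toSubmonoid] at hg
  obtain ⟨l, hl, hprod⟩ := Submonoid.exists_list_of_mem_closure hg
  have hl' : ∀ x ∈ l, x ∈ commutatorSet G := fun x hx =>
    (hl x hx).elim id fun h => inv_inv x ▸ inv_mem_commutatorSet h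
  exact Nat.sInf_mem (s := {n | ∃ l : List G, l.length = n ∧ (∀ x ∈ l, x ∈ commutatorSet G) ∧
    l.prod = g}) ⟨_, l, rfl, hl', hprod⟩

theorem commutatorLength_mul_le (hg : g ∈ commutator G) (hh : h ∈ commutator G) :
    commutatorLength (g * h) ≤ commutatorLength g + commutatorLength h := by
  obtain ⟨l, hlen, hl, rfl⟩ := exists_list_length_eq_commutatorLength hg
  obtain ⟨m, hlen', hm, rfl⟩ := exists_list_length_eq_commutatorLength hh
  exact Nat.sInf_le ⟨l ++ m, by rw [List.length_append, hlen, hlen'],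
    List.forall_mem_append.2 ⟨hl, hm⟩, List.prod_append⟩

theorem tendsto_scl (hg : g ∈ commutator G) :
    Tendsto (fun n : ℕ => (commutatorLength (g ^ n) : ℝ) / n) atTop (𝓝 (scl g)) := by
  have hsub : Subadditive fun n : ℕ => (commutatorLength (g ^ n) : ℝ) := fun m n => by
    simp only [pow_add]
    exact_mod_cast commutatorLength_mul_le (Subgroup.pow_mem _ hg m) (Subgroup.pow_mem _ hg n)
  exact tendsto_nhds_limUnder ⟨_, hsub.tendsto_lim ⟨0, by rintro _ ⟨n, rfl⟩; positivity⟩⟩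

theorem SclAtLeast.mono {c c' : ℝ} (h : SclAtLeast g c) (hc : c' ≤ c) : SclAtLeast g c' :=
  ⟨h.1, hc.trans h.2⟩

section Quasimorphism

variable {f : G → ℝ} {D : ℝ}

theorem quasimorphism_prod_le (hinv : ∀ a, f a⁻¹ = -f a)
    (hD : ∀ a b, |f (a * b) - f a - f b| ≤ D) {l : List G} (hl : ∀ x ∈ l, x ∈ commutatorSet G) :
    f l.prod ≤ 4 * D * l.length := by
  have mul_le (a b : G) : f (a * b) ≤ f a + f b + D := by linarith [(abs_le.1 (hD a b)).2]
  induction l with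
  | nil =>
    have := hinv 1
    rw [inv_one] at this
    simp only [List.prod_nil, List.length_nil, Nat.cast_zero, mul_zero]
    linarith
  | cons x l ih =>
    rw [List.forall_mem_cons] at hl
    obtain ⟨⟨a, b, rfl⟩, hl⟩ := hl
    have hcomm : f ⁅a, b⁆ ≤ 3 * D := by
      rw [commutatorElement_def]
      linarith [mul_le (a * b * a⁻¹) b⁻¹, mul_le (a * b) a⁻¹, mul_le a b, hinv a, hinv b]
    rw [List.prod_cons, List.length_cons, Nat.cast_add, Nat.cast_one]
    linarith [mul_le ⁅a, b⁆ l.prod, ih hl]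

/-- The quasimorphism need not be homogeneous: a bounded error disappears in the limit. -/
theorem sclAtLeast_of_quasimorphism (hinv : ∀ a, f a⁻¹ = -f a)
    (hD : ∀ a b, |f (a * b) - f a - f b| ≤ D) (hpos : 0 < D) (hg : g ∈ commutator G) {c C : ℝ}
    (hf : ∀ n : ℕ, c * n - C ≤ f (g ^ n)) : SclAtLeast g (c / (4 * D)) := by
  refine ⟨tendsto_scl hg, ?_⟩
  have hlim : Tendsto (fun n : ℕ => (c - C / n) / (4 * D)) atTop (𝓝 (c / (4 * D))) := by
    simpa only [sub_zero] using
      ((tendsto_const_div_atTop_nhds_zero_nat C).const_sub c).div_const (4 * D)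
  refine le_of_tendsto_of_tendsto hlim (tendsto_scl hg) ?_
  filter_upwards [eventually_gt_atTop 0] with n hn
  obtain ⟨l, hlen, hl, hprod⟩ := exists_list_length_eq_commutatorLength (Subgroup.pow_mem _ hg n)
  have hle : c * n - C ≤ 4 * D * commutatorLength (g ^ n) := by
    rw [← hlen]
    exact (hf n).trans (hprod ▸ quasimorphism_prod_le hinv hD hl)
  have hn' : (0 : ℝ) < n := Nat.cast_pos.2 hn
  rw [div_le_div_iff₀ (by positivity) hn', sub_mul, div_mul_cancel₀ _ hn'.ne']
  linarith

end Quasimorphism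

end StableCommutatorLength

namespace SquareComplex

variable {V : Type u} {S : SquareComplex V} {G : Type*} [Group G] [MulAction G V] {g : G}

theorem isChain_pow {Φ : Set V} {a : V} (hg : g • Φ ⊆ Φ) (ha : a ∈ Φ) (ha' : a ∉ g • Φ) (n : ℕ) :
    IsChain g Φ a (g ^ n • a) ((List.range (n - 1)).map fun i => g ^ (i + 1)) := by
  have hanti := antitone_pow_smul hg
  refine ⟨List.pairwise_map.2 <| List.pairwise_lt_range.imp fun hij => ?_,
    List.forall_mem_map.2 fun i _ hmem => ha' ?_, List.forall_mem_map.2 fun i hi => ?_⟩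
  · rw [smul_smul, ← pow_succ]
    exact hanti (Nat.succ_le_succ hij)
  · simpa only [pow_one] using hanti (Nat.le_add_left 1 i) hmem
  · rw [smul_smul, ← pow_succ]
    rw [List.mem_range] at hi
    exact hanti (by omega : i + 1 + 1 ≤ n) (Set.smul_mem_smul_set ha)

namespace IsTameAction

variable [S.SimplyConnected]

theorem sub_one_le_chainCount_pow (H : S.IsTameAction G) {a b : V} (hab : S.graph.Adj a b)
    (hg : g • S.half a b ⊂ S.half a b) (n : ℕ) :
    (n : ℤ) - 1 ≤ chainCount g (S.half a b) a (g ^ n • a) := by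
  have hΦ := half_mem_halfspaces hab
  have ha : a ∉ g • S.half a b := fun ha =>
    hg.ne (eq_half_of_adj (H.isAction.smul_mem_halfspaces g hΦ) hab ha
      fun hb => right_notMem_half (hg.subset hb))
  have hforward := H.length_le_chainNumber hΦ hg
    (isChain_pow hg.subset (left_mem_half hab) ha n)
  rw [List.length_map, List.length_range] at hforward
  obtain ⟨l, hl, hbackward⟩ := H.exists_isChain_length_eq hΦ hg (g ^ n • a) a
  have hnil : l = [] := List.eq_nil_iff_forall_not_mem.2 fun h hh =>
    hl.notMem h hh (H.pow_smul_mem hab hg.subset (hl.mem h hh))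
  rw [hnil, List.length_nil] at hbackward
  rw [chainCount]
  omega

/-- The counting function along the orbit of a vertex is a quasimorphism of defect `3`. -/
theorem sclAtLeast (H : S.IsTameAction G) (hg : g ∈ commutator G) (hne : ∃ x : V, g • x ≠ x) :
    SclAtLeast g (1 / 12) := by
  obtain ⟨a, b, hab, hlt⟩ := H.exists_smul_half_ssubset hne
  set f : G → ℤ := fun h => chainCount g (S.half a b) a (h • a)
  have hinv (h : G) : f h⁻¹ = -f h := by
    simp only [f, neg_chainCount]
    rw [← chainCount_smul h a, smul_inv_smul]
  have hdefect (h k : G) : |f (h * k) - f h - f k| ≤ 3 := by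
    have := H.abs_chainCount_triangle_le (half_mem_halfspaces hab) hlt a (h • a) ((h * k) • a)
    rwa [mul_smul, chainCount_smul, ← mul_smul] at this
  have hgrowth := H.sub_one_le_chainCount_pow hab hlt
  convert sclAtLeast_of_quasimorphism (f := fun h => (f h : ℝ)) (D := 3) (c := 1) (C := 1)
    (fun h => mod_cast hinv h) (fun h k => mod_cast hdefect h k) (by norm_num) hg
    (fun n => by rw [one_mul]; exact_mod_cast hgrowth n) using 1
  norm_num

end IsTameAction

end SquareComplex

/-! ### The 2-skeleton of a cube complex -/

section Flip

variable {ι : Type*} [DecidableEq ι] {x y : ι → Bool} {i j : ι}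

/-- The vertex of a cube obtained from `x` by changing the coordinate `i`. -/
def flipAt (x : ι → Bool) (i : ι) : ι → Bool := Function.update x i (!x i)

theorem flipAt_apply (x : ι → Bool) (i j : ι) :
    flipAt x i j = if j = i then !x j else x j := by
  rw [flipAt, Function.update_apply]
  grind

theorem flipAt_ne (x : ι → Bool) (i : ι) : flipAt x i ≠ x := fun h => by
  simpa [flipAt_apply] using congrFun h i

theorem flipAt_comm (x : ι → Bool) (i j : ι) :
    flipAt (flipAt x i) j = flipAt (flipAt x j) i := by
  ext k
  grind [flipAt_apply]

theorem flipAt_injective (x : ι → Bool) : Function.Injective (flipAt x) := fun i j h => by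
  have := congrFun h i
  grind [flipAt_apply]

theorem flipAt_flipAt_ne (x : ι → Bool) (h : i ≠ j) : flipAt (flipAt x i) j ≠ x := fun e => by
  have := congrFun e i
  grind [flipAt_apply]

theorem cubeFace_compl_singleton {n : ℕ} (x : Fin n → Bool) (i : Fin n) :
    cubeFace {i}ᶜ x = {x, flipAt x i} := by
  ext z
  simp only [cubeFace, Set.mem_compl_singleton_iff, Set.mem_ofPred_eq, Set.mem_insert_iff,
    Set.mem_singleton_iff, funext_iff, flipAt_apply]
  grind [Bool.eq_or_eq_not (z i) (x i)]

theorem cubeFace_compl_pair {n : ℕ} (x : Fin n → Bool) (i j : Fin n) :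
    cubeFace {i, j}ᶜ x = {x, flipAt x i, flipAt (flipAt x i) j, flipAt x j} := by
  ext z
  simp only [cubeFace, Set.mem_compl_iff, Set.mem_ofPred_eq, Set.mem_insert_iff,
    Set.mem_singleton_iff, funext_iff, flipAt_apply]
  grind [Bool.eq_or_eq_not (z i) (x i), Bool.eq_or_eq_not (z j) (x j)]

end Flip

namespace CubeComplex

variable {V : Type u} {X : CubeComplex V}

variable (X) in
/-- A parametrization of a cube by its combinatorial model: the cubes contained in the image of `f`
are the images of the faces of the model. -/
structure IsChart {n : ℕ} (f : (Fin n → Bool) → V) : Prop where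
  injective : Function.Injective f
  mem_cubes_iff : ∀ D ⊆ Set.range f, D ∈ X.cubes ↔ ∃ S a, D = f '' cubeFace S a

theorem exists_isChart {C : Set V} (hC : C ∈ X.cubes) :
    ∃ (n : ℕ) (f : (Fin n → Bool) → V), X.IsChart f ∧ Set.range f = C := by
  obtain ⟨n, f, hf, rfl, hfaces⟩ := X.exists_param C hC
  exact ⟨n, f, ⟨hf, hfaces⟩, rfl⟩

theorem ncard_ne_three {C : Set V} (hC : C ∈ X.cubes) : C.ncard ≠ 3 := by
  obtain ⟨n, f, hf, rfl⟩ := exists_isChart hC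
  rw [Set.ncard_range_of_injective hf.injective, Nat.card_fun, Nat.card_fin,
    Nat.card_eq_fintype_card, Fintype.card_bool]
  cases n <;> grind

namespace IsSquare

variable {a b c d : V}

theorem rotate (h : X.IsSquare a b c d) : X.IsSquare b c d a where
  adj_ab := h.adj_bc
  adj_bc := h.adj_cd
  adj_cd := h.adj_da
  adj_da := h.adj_ab
  ne_ac := h.ne_bd
  ne_bd := h.ne_ac.symm
  mem := by
    convert h.mem using 1
    grind

theorem flip (h : X.IsSquare a b c d) : X.IsSquare a d c b where
  adj_ab := h.adj_da.symm
  adj_bc := h.adj_cd.symm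
  adj_cd := h.adj_bc.symm
  adj_da := h.adj_ab.symm
  ne_ac := h.ne_ac
  ne_bd := h.ne_bd.symm
  mem := by
    convert h.mem using 1
    grind

theorem mem_of_mem (h : X.IsSquare a b c d) {C : Set V} (hC : C ∈ X.cubes) (ha : a ∈ C)
    (hb : b ∈ C) (hd : d ∈ C) : c ∈ C := by
  by_contra hc
  have hinter : C ∩ {a, b, c, d} = {a, b, d} := by grind
  refine ncard_ne_three (X.inter_mem C hC _ h.mem ⟨a, ha, by simp⟩) ?_
  exact Set.ncard_eq_three.2 ⟨a, b, d, h.adj_ab.ne, h.adj_da.ne', h.ne_bd, hinter⟩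

theorem unique {d' : V} (h : X.IsSquare a b c d) (h' : X.IsSquare a b c d') : d = d' := by
  have hd : d ∈ ({a, b, c, d'} : Set V) :=
    h.rotate.mem_of_mem h'.mem (by simp) (by simp) (by simp)
  have := h.adj_cd.ne
  have := h.adj_da.ne
  have := h.ne_bd
  grind

end IsSquare

namespace IsChart

variable {n : ℕ} {f : (Fin n → Bool) → V} {i j k : Fin n}

theorem image_cubeFace_mem_cubes (hf : X.IsChart f) (S : Set (Fin n)) (a : Fin n → Bool) :
    f '' cubeFace S a ∈ X.cubes :=
  (hf.mem_cubes_iff _ (Set.image_subset_range _ _)).2 ⟨S, a, rfl⟩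

theorem adj_flipAt (hf : X.IsChart f) (x : Fin n → Bool) (i : Fin n) :
    X.skeleton.Adj (f x) (f (flipAt x i)) := by
  refine ⟨hf.injective.ne (flipAt_ne x i).symm, ?_⟩
  rw [← Set.image_pair, ← cubeFace_compl_singleton]
  exact hf.image_cubeFace_mem_cubes _ _

theorem isSquare_flipAt (hf : X.IsChart f) (x : Fin n → Bool) (hij : i ≠ j) :
    X.IsSquare (f x) (f (flipAt x i)) (f (flipAt (flipAt x i) j)) (f (flipAt x j)) where
  adj_ab := hf.adj_flipAt x i
  adj_bc := hf.adj_flipAt _ j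
  adj_cd := by
    rw [flipAt_comm]
    exact (hf.adj_flipAt _ i).symm
  adj_da := (hf.adj_flipAt x j).symm
  ne_ac := hf.injective.ne (flipAt_flipAt_ne x hij).symm
  ne_bd := hf.injective.ne ((flipAt_injective x).ne hij)
  mem := by
    have := hf.image_cubeFace_mem_cubes {i, j}ᶜ x
    simpa only [cubeFace_compl_pair, Set.image_insert_eq, Set.image_singleton] using this

theorem exists_flipAt_of_adj (hf : X.IsChart f) {x : Fin n → Bool} {v : V} (hv : v ∈ Set.range f)
    (h : X.skeleton.Adj (f x) v) : ∃ i, v = f (flipAt x i) := by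
  obtain ⟨y, rfl⟩ := hv
  obtain ⟨S, a, hface⟩ := (hf.mem_cubes_iff _ (by grind)).1 h.2
  have mem_face (z : Fin n → Bool) : z ∈ cubeFace S a ↔ z = x ∨ z = y := by
    rw [← hf.injective.mem_set_image, ← hface]
    simp only [Set.mem_insert_iff, Set.mem_singleton_iff, hf.injective.eq_iff]
  have hx := (mem_face x).2 (.inl rfl)
  have hy := (mem_face y).2 (.inr rfl)
  obtain ⟨i, hi⟩ : ∃ i, x i ≠ y i := Function.ne_iff.1 fun e => h.1 (congrArg f e)
  have hflip : flipAt x i ∈ cubeFace S a := fun k hk => by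
    rw [flipAt_apply, if_neg, hx k hk]
    rintro rfl
    exact hi ((hx k hk).trans (hy k hk).symm)
  exact ⟨i, congrArg f (((mem_face _).1 hflip).resolve_left (flipAt_ne x i)).symm⟩

theorem eq_flipAt_flipAt (hf : X.IsChart f) {x : Fin n → Bool} {p : V}
    (h : X.IsSquare (f x) (f (flipAt x i)) p (f (flipAt x j))) :
    i ≠ j ∧ p = f (flipAt (flipAt x i) j) := by
  have hij : i ≠ j := fun e => h.ne_bd (by rw [e])
  exact ⟨hij, h.rotate.rotate.rotate.unique (hf.isSquare_flipAt x hij).rotate.rotate.rotate⟩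

end IsChart

theorem HasFlagLinks.exists_mem_cubes (hX : X.HasFlagLinks) {v x y z p q r : V}
    (hxy : X.IsSquare v x p y) (hyz : X.IsSquare v y q z) (hzx : X.IsSquare v z r x) :
    ∃ C ∈ X.cubes, v ∈ C ∧ x ∈ C ∧ y ∈ C ∧ z ∈ C := by
  have common_cube {a b c d : V} (h : X.IsSquare a b c d) : ∃ C ∈ X.cubes, a ∈ C ∧ b ∈ C ∧ d ∈ C :=
    ⟨_, h.mem, by simp, by simp, by simp⟩
  obtain ⟨C, hC, hv, hS⟩ := hX v {x, y, z} (Set.toFinite _)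
    (by
      rintro u (rfl | rfl | rfl)
      exacts [hxy.adj_ab, hyz.adj_ab, hzx.adj_ab])
    (by
      rintro u (rfl | rfl | rfl) u' (rfl | rfl | rfl) hne
      exacts [absurd rfl hne, common_cube hxy, common_cube hzx.flip, common_cube hxy.flip,
        absurd rfl hne, common_cube hyz, common_cube hzx, common_cube hyz.flip, absurd rfl hne])
  exact ⟨C, hC, hv, hS (by simp), hS (by simp), hS (by simp)⟩

theorem HasFlagLinks.exists_cube (hX : X.HasFlagLinks) {v x y z p q r : V}
    (hxy : X.IsSquare v x p y) (hyz : X.IsSquare v y q z) (hzx : X.IsSquare v z r x) :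
    ∃ s, X.IsSquare x p s r ∧ X.IsSquare y q s p ∧ X.IsSquare z r s q := by
  obtain ⟨C, hC, hv, hx, hy, hz⟩ := hX.exists_mem_cubes hxy hyz hzx
  obtain ⟨n, f, hf, rfl⟩ := exists_isChart hC
  obtain ⟨o, rfl⟩ := hv
  obtain ⟨i, rfl⟩ := hf.exists_flipAt_of_adj hx hxy.adj_ab
  obtain ⟨j, rfl⟩ := hf.exists_flipAt_of_adj hy hyz.adj_ab
  obtain ⟨k, rfl⟩ := hf.exists_flipAt_of_adj hz hzx.adj_ab
  obtain ⟨hij, rfl⟩ := hf.eq_flipAt_flipAt hxy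
  obtain ⟨hjk, rfl⟩ := hf.eq_flipAt_flipAt hyz
  obtain ⟨hki, rfl⟩ := hf.eq_flipAt_flipAt hzx
  refine ⟨f (flipAt (flipAt (flipAt o i) j) k), ?_, ?_, ?_⟩
  · simpa only [flipAt_comm o k i] using hf.isSquare_flipAt (flipAt o i) hjk
  · simpa only [flipAt_comm (flipAt o j) k i, flipAt_comm o j i] using
      hf.isSquare_flipAt (flipAt o j) hki
  · simpa only [flipAt_comm (flipAt o k) i j, flipAt_comm o k j, flipAt_comm (flipAt o j) k i,
      flipAt_comm o j i] using hf.isSquare_flipAt (flipAt o k) hij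

variable (X) in
/-- The 2-skeleton of a cube complex with flag links. -/
abbrev toSquareComplex (hX : X.HasFlagLinks) : SquareComplex V where
  graph := X.skeleton
  IsSquare := X.IsSquare
  adj_of_isSquare h := h.adj_ab
  ne_of_isSquare h := h.ne_ac
  rotate_isSquare h := h.rotate
  flip_isSquare h := h.flip
  eq_of_isSquare h h' := h.unique h'
  exists_cube := hX.exists_cube

end CubeComplex

namespace SquareComplex.LocalSystem

variable {V : Type u} {S : SquareComplex V} {T : Type*} (L : S.LocalSystem T) {x y z : V} {t : T}

/-- Transport along an edge path. -/
def transportAlong : ∀ {x y : V}, S.graph.Walk x y → T → T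
  | _, _, .nil, t => t
  | _, _, .cons (u := x) (v := y) _ p, t => transportAlong p (L.transport x y t)

theorem transportAlong_append (p : S.graph.Walk x y) (q : S.graph.Walk y z) (t : T) :
    L.transportAlong (p.append q) t = L.transportAlong q (L.transportAlong p t) := by
  induction p generalizing t with
  | nil => rfl
  | cons _ _ ih => exact ih q _

theorem transportAlong_mem (p : S.graph.Walk x y) (ht : t ∈ L.fibre x) :
    L.transportAlong p t ∈ L.fibre y := by
  induction p generalizing t with
  | nil => exact ht
  | cons h _ ih => exact ih (L.mapsTo h ht)

end SquareComplex.LocalSystem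

namespace CubeComplex

variable {V : Type u} {X : CubeComplex V} {hX : X.HasFlagLinks}

theorem Homotopic.transportAlong_eq {T : Type*} (L : (X.toSquareComplex hX).LocalSystem T)
    {x y : V} {p q : X.skeleton.Walk x y} (h : X.Homotopic p q) {t : T} (ht : t ∈ L.fibre x) :
    L.transportAlong p t = L.transportAlong q t := by
  induction h generalizing t with
  | refl => rfl
  | symm _ ih => exact (ih ht).symm
  | trans _ _ ih ih' => exact (ih ht).trans (ih' ht)
  | @append _ _ _ p p' q q' _ _ ih ih' =>
    have hp' := L.transportAlong_mem p' ht
    rw [L.transportAlong_append, L.transportAlong_append, ih ht, ih' hp']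
  | backtrack h => exact L.leftInvOn h ht
  | square h => exact L.eqOn h ht

theorem IsSimplyConnected.toSquareComplex (h : X.IsSimplyConnected) :
    (X.toSquareComplex hX).SimplyConnected where
  connected := h.1
  exists_section {T} L v t ht := by
    have loop {x : V} (p : X.skeleton.Walk x x) {s : T} (hs : s ∈ L.fibre x) :
        L.transportAlong p s = s :=
      (h.2 x p).transportAlong_eq L hs
    have walk (x : V) : X.skeleton.Walk v x := (h.1.preconnected v x).some
    refine ⟨fun x => L.transportAlong (walk x) t, loop (walk v) ht, fun x y hxy => ?_⟩
    set s := L.transport x y (L.transportAlong (walk x) t)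
    have hs : s ∈ L.fibre y := L.mapsTo hxy (L.transportAlong_mem _ ht)
    have hback : L.transportAlong (walk y).reverse s = t := by
      have := loop ((walk x).append (.cons hxy (walk y).reverse)) ht
      rwa [L.transportAlong_append] at this
    have := loop ((walk y).reverse.append (walk y)) hs
    rwa [L.transportAlong_append, hback] at this

theorem parallel_of_toSquareComplex {a b x y : V}
    (h : (X.toSquareComplex hX).Parallel a b x y) : X.Parallel s(a, b) s(x, y) := by
  induction h with
  | refl => exact .refl _
  | step _ hq ih => exact ih.trans _ _ _ (.rel _ _ ⟨_, _, _, _, hq, rfl, rfl⟩)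

variable [(X.toSquareComplex hX).SimplyConnected]

theorem Parallel.sym2_half_eq {a b x y : V} (h : X.Parallel s(a, b) s(x, y)) :
    s((X.toSquareComplex hX).half a b, (X.toSquareComplex hX).half b a) =
      s((X.toSquareComplex hX).half x y, (X.toSquareComplex hX).half y x) := by
  let sides : Sym2 V → Sym2 (Set V) := Sym2.lift
    ⟨fun a b => s((X.toSquareComplex hX).half a b, (X.toSquareComplex hX).half b a),
      fun _ _ => Sym2.eq_swap⟩
  suffices ∀ {e e'}, X.Parallel e e' → sides e = sides e' from this h
  intro e e' h
  induction h with
  | rel _ _ h =>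
    obtain ⟨a, b, c, d, hq, rfl, rfl⟩ := h
    have hq : (X.toSquareComplex hX).IsSquare a b c d := hq
    simp only [sides, Sym2.lift_mk, hq.half_eq, hq.rotate.flip.half_eq]
  | refl => rfl
  | symm _ _ _ ih => exact ih.symm
  | trans _ _ _ _ _ ih ih' => exact ih.trans ih'

theorem side_subset_half {a b : V} (hab : X.skeleton.Adj a b) :
    X.side a b ⊆ (X.toSquareComplex hX).half a b := by
  rintro x ⟨p⟩
  suffices ∀ {u v : V}, (X.skeleton.deleteEdges {e | X.Parallel s(a, b) e}).Walk u v →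
      u ∈ (X.toSquareComplex hX).half a b → v ∈ (X.toSquareComplex hX).half a b from
    this p (SquareComplex.left_mem_half hab)
  intro u v p hu
  induction p with
  | nil => exact hu
  | cons h _ ih =>
    rw [SimpleGraph.deleteEdges_adj] at h
    by_contra hv
    exact h.2 <| parallel_of_toSquareComplex <|
      SquareComplex.parallel_of_mem_half hab h.1 hu fun hw => hv (ih hw)

theorem half_subset_side {a b : V} (hab : X.skeleton.Adj a b) :
    (X.toSquareComplex hX).half a b ⊆ X.side a b := by
  intro x hx
  induction hn : (X.toSquareComplex hX).graph.dist a x generalizing x with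
  | zero =>
    obtain rfl := SquareComplex.SimplyConnected.connected.dist_eq_zero_iff.1 hn
    exact SimpleGraph.Reachable.refl _
  | succ n ih =>
    obtain ⟨y, hyx, hy⟩ := (X.toSquareComplex hX).exists_adj_dist_add_one_eq
      (o := a) (x := x) (by rintro rfl; simp at hn)
    have hyI : y ∈ (X.toSquareComplex hX).interval a x := by
      rw [SquareComplex.mem_interval, SimpleGraph.dist_eq_one_iff_adj.2 hyx, hy]
    have hyH := SquareComplex.interval_subset_of_mem_halfspaces
      (SquareComplex.half_mem_halfspaces hab) (SquareComplex.left_mem_half hab) hx hyI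
    refine (ih hyH (by omega)).trans (SimpleGraph.Adj.reachable ?_)
    rw [SimpleGraph.deleteEdges_adj]
    refine ⟨hyx, fun hp => ?_⟩
    rcases Sym2.eq_iff.1 (hp.sym2_half_eq (hX := hX)) with ⟨h, -⟩ | ⟨h, -⟩
    · exact SquareComplex.right_notMem_half (h ▸ hx)
    · exact SquareComplex.right_notMem_half (h ▸ hyH)

theorem side_eq_half {a b : V} (hab : X.skeleton.Adj a b) :
    X.side a b = (X.toSquareComplex hX).half a b :=
  (side_subset_half hab).antisymm (half_subset_side hab)

variable (hX) in
theorem halfspaces_eq : X.halfspaces = (X.toSquareComplex hX).halfspaces := by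
  ext Φ
  exact exists₂_congr fun a b => and_congr_right fun hab => by rw [side_eq_half (hX := hX) hab]

variable {G : Type*} [Group G] [MulAction G V]

variable (X G) in
/-- Actions for which every hyperplane is two-sided, disjoint from its translates and free of
self-osculations. Compared with RAAG-like actions, interosculation is allowed. -/
structure IsTameAction : Prop where
  isAction : X.IsAction G
  no_inversion : ∀ Φ ∈ X.halfspaces, ∀ h : G, h • Φᶜ ≠ Φ
  nested : ∀ Φ ∈ X.halfspaces, ∀ h : G, Nested Φ (h • Φ)
  no_selfosculation : ∀ Φ ∈ X.halfspaces, ∀ h : G, Φ ⊆ h • Φᶜ → ¬ X.TightlyNested Φ (h • Φᶜ)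

theorem IsRAAGLikeAction.isTameAction (H : X.IsRAAGLikeAction G) : X.IsTameAction G where
  isAction := H.isAction
  no_inversion Φ hΦ h e := H.no_inversion ⟨Φ, hΦ, h, e⟩
  nested Φ hΦ h := not_not.1 fun hn => H.nonTransverse ⟨Φ, hΦ, h, hn⟩
  no_selfosculation Φ hΦ h hle ht := H.no_selfosculation ⟨Φ, hΦ, h, hle, ht⟩

theorem tightlyNested_of_ssubset {Φ Ψ : Set V} (h : Φ ⊂ Ψ) (hΦ : Φ.Nonempty) (hΨ : Ψ ≠ Set.univ)
    (ht : ¬ ∃ Θ ∈ X.halfspaces, Φ ⊂ Θ ∧ Θ ⊂ Ψ) : X.TightlyNested Φ Ψ where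
  ne := h.ne
  nested := .inl h.subset
  tight := by
    rintro ⟨Θ, hΘ, h' | ⟨hΦΘ, hΘΨ⟩ | ⟨hΦΘ, hΘΨ⟩ | ⟨hΦΘ, hΘΨ⟩⟩
    · exact ht ⟨Θ, hΘ, h'⟩
    · refine hΨ (Set.univ_subset_iff.1 ?_)
      rw [← Set.union_compl_self Φ]
      exact Set.union_subset h.subset (hΦΘ.trans hΘΨ).subset
    · obtain ⟨x, hx⟩ := hΦ
      exact hΘΨ.subset (hΦΘ.subset hx) (h.subset hx)
    · exact h.not_subset (Set.compl_subset_compl.1 (hΦΘ.trans hΘΨ).subset)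

theorem IsTameAction.toSquareComplex (H : X.IsTameAction G) :
    (X.toSquareComplex hX).IsTameAction G where
  isAction g x y h := by
    refine ⟨(MulAction.injective g).ne h.1, ?_⟩
    simpa only [Set.smul_set_insert, Set.smul_set_singleton] using H.isAction g _ h.2
  no_inversion := by
    intro Φ hΦ h e
    refine H.no_inversion Φ (halfspaces_eq hX ▸ hΦ) h ?_
    rw [Set.smul_set_compl, e, compl_compl]
  nested := halfspaces_eq hX ▸ H.nested
  no_osculation := by
    intro Φ hΦ h hlt
    have hne := SquareComplex.nonempty_of_mem_halfspaces hΦ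
    rw [← halfspaces_eq hX] at hΦ ⊢
    by_contra hn
    rw [← Set.smul_set_compl] at hlt hn
    refine H.no_selfosculation Φ hΦ h hlt.subset (tightlyNested_of_ssubset hlt hne ?_ hn)
    rw [Set.smul_set_compl, Ne, Set.compl_univ_iff, Set.smul_set_eq_empty]
    exact hne.ne_empty

end CubeComplex

/-! ### The Cayley complex of a right-angled Artin group -/

namespace RAAG

variable {W : Type w} {Γ : SimpleGraph W}

variable (Γ) in
/-- The generator of a right-angled Artin group that belongs to a vertex. -/
def gen (a : W) : RAAG Γ := PresentedGroup.of a

variable (Γ) in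
/-- `s` is the generator `a` or its inverse. -/
def IsLetter (a : W) (s : RAAG Γ) : Prop := s = gen Γ a ∨ s = (gen Γ a)⁻¹

theorem isLetter_gen (a : W) : IsLetter Γ a (gen Γ a) := .inl rfl

theorem isLetter_gen_inv (a : W) : IsLetter Γ a (gen Γ a)⁻¹ := .inr rfl

theorem commute_gen {a b : W} (h : Γ.Adj a b) : Commute (gen Γ a) (gen Γ b) := by
  rw [← commutatorElement_eq_one_iff_commute]
  exact PresentedGroup.one_of_mem ⟨a, b, h, rfl⟩

/-- The universal property of a right-angled Artin group. -/
def lift {H : Type*} [Group H] (f : W → H) (hf : ∀ a b, Γ.Adj a b → Commute (f a) (f b)) :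
    RAAG Γ →* H :=
  PresentedGroup.toGroup (f := f) (by
    rintro _ ⟨a, b, h, rfl⟩
    rw [map_commutatorElement, FreeGroup.lift_apply_of, FreeGroup.lift_apply_of]
    exact commutatorElement_eq_one_iff_commute.2 (hf a b h))

theorem lift_gen {H : Type*} [Group H] (f : W → H) (hf : ∀ a b, Γ.Adj a b → Commute (f a) (f b))
    (a : W) : lift f hf (gen Γ a) = f a :=
  PresentedGroup.toGroup.of _

open Classical in
/-- The exponent sum of a generator. -/
noncomputable def exponent (a : W) : RAAG Γ →* Multiplicative ℤ :=
  lift (fun b => if b = a then .ofAdd 1 else 1) fun _ _ _ => .all _ _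

theorem exponent_gen_self (a : W) : exponent a (gen Γ a) = .ofAdd 1 := by
  rw [exponent, lift_gen, if_pos rfl]

theorem exponent_gen_of_ne {a b : W} (h : b ≠ a) : exponent a (gen Γ b) = 1 := by
  rw [exponent, lift_gen, if_neg h]

@[elab_as_elim]
theorem gen_induction {P : RAAG Γ → Prop} (one : P 1) (gen : ∀ a, P (gen Γ a))
    (mul : ∀ x y, P x → P y → P (x * y)) (inv : ∀ x, P x → P x⁻¹) (x : RAAG Γ) : P x := by
  have hx : x ∈ Subgroup.closure (Set.range (RAAG.gen Γ)) :=
    (PresentedGroup.closure_range_of _).symm ▸ Subgroup.mem_top x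
  induction hx using Subgroup.closure_induction with
  | mem x hx =>
    obtain ⟨a, rfl⟩ := hx
    exact gen a
  | one => exact one
  | mul x y _ _ hx hy => exact mul x y hx hy
  | inv x _ hx => exact inv x hx

namespace IsLetter

variable {a b : W} {s t : RAAG Γ}

theorem inv (h : IsLetter Γ a s) : IsLetter Γ a s⁻¹ := by
  rcases h with rfl | rfl
  · exact isLetter_gen_inv a
  · simpa only [inv_inv] using isLetter_gen a

theorem commute (hs : IsLetter Γ a s) (ht : IsLetter Γ b t) (h : Γ.Adj a b) : Commute s t := by
  rcases hs with rfl | rfl <;> rcases ht with rfl | rfl <;> simpa using commute_gen h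

theorem exponent_eq_one (h : IsLetter Γ b s) (hba : b ≠ a) : exponent a s = 1 := by
  rcases h with rfl | rfl
  · exact exponent_gen_of_ne hba
  · rw [map_inv, exponent_gen_of_ne hba, inv_one]

theorem exponent_ne_inv (h : IsLetter Γ a s) : exponent a s ≠ (exponent a s)⁻¹ := by
  rcases h with rfl | rfl <;> simp only [map_inv, exponent_gen_self] <;> decide

theorem ne_inv (h : IsLetter Γ a s) : s ≠ s⁻¹ := fun e =>
  h.exponent_ne_inv (by rw [← map_inv, ← e])

theorem ne_one (h : IsLetter Γ a s) : s ≠ 1 := by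
  rintro rfl
  exact h.ne_inv inv_one.symm

theorem mul_ne_one (hs : IsLetter Γ a s) (ht : IsLetter Γ b t) (h : Γ.Adj a b) : s * t ≠ 1 := by
  rintro e
  obtain rfl := eq_inv_of_mul_eq_one_left e
  exact hs.exponent_ne_inv (by rw [map_inv, ht.exponent_eq_one h.ne', inv_one, inv_one])

end IsLetter

variable (Γ) in
/-- The Cayley graph of the standard generators, on which the group acts by left multiplication. -/
def cayley : SimpleGraph (RAAG Γ) where
  Adj x y := ∃ a, IsLetter Γ a (x⁻¹ * y)
  symm := ⟨fun x y ⟨a, h⟩ => ⟨a, by simpa using h.inv⟩⟩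
  loopless := ⟨fun x ⟨a, h⟩ => h.ne_one (by simp)⟩

theorem cayley_adj_mul (x : RAAG Γ) {a : W} {s : RAAG Γ} (h : IsLetter Γ a s) :
    (cayley Γ).Adj x (x * s) :=
  ⟨a, by simpa using h⟩

theorem cayley_connected : (cayley Γ).Connected := by
  have reachable_mul (x y : RAAG Γ) : (cayley Γ).Reachable x (x * y) := by
    induction y using gen_induction generalizing x with
    | one => rw [mul_one]
    | gen a => exact (cayley_adj_mul x (isLetter_gen a)).reachable
    | mul y z hy hz => exact mul_assoc x y z ▸ (hy x).trans (hz _)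
    | inv y hy => simpa using (hy (x * y⁻¹)).symm
  exact ⟨fun x y => by simpa using reachable_mul x (x⁻¹ * y)⟩

/-- The squares of the Cayley complex, with their vertices in cyclic order: two edges at a vertex
span a square if their labels are adjacent in `Γ`. -/
def IsCayleySquare (x y z x' : RAAG Γ) : Prop :=
  ∃ a b s t, Γ.Adj a b ∧ IsLetter Γ a s ∧ IsLetter Γ b t ∧ y = x * s ∧ z = x * s * t ∧ x' = x * t

namespace IsCayleySquare

variable {x y z x' : RAAG Γ}

theorem adj : IsCayleySquare x y z x' → (cayley Γ).Adj x y := by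
  rintro ⟨a, b, s, t, -, hs, -, rfl, -, -⟩
  exact cayley_adj_mul x hs

theorem ne : IsCayleySquare x y z x' → x ≠ z := by
  rintro ⟨a, b, s, t, hab, hs, ht, -, rfl, -⟩
  rw [mul_assoc, Ne, left_eq_mul]
  exact hs.mul_ne_one ht hab

theorem rotate : IsCayleySquare x y z x' → IsCayleySquare y z x' x := by
  rintro ⟨a, b, s, t, hab, hs, ht, rfl, rfl, rfl⟩
  refine ⟨b, a, t, s⁻¹, hab.symm, ht, hs.inv, rfl, ?_, (mul_inv_cancel_right x s).symm⟩
  rw [(hs.commute ht hab).right_comm, mul_inv_cancel_right]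

theorem flip : IsCayleySquare x y z x' → IsCayleySquare x x' z y := by
  rintro ⟨a, b, s, t, hab, hs, ht, rfl, rfl, rfl⟩
  exact ⟨b, a, t, s, hab.symm, ht, hs, rfl, (hs.commute ht hab).right_comm x, rfl⟩

theorem unique {x'' : RAAG Γ} :
    IsCayleySquare x y z x' → IsCayleySquare x y z x'' → x' = x'' := by
  rintro ⟨a, b, s, t, -, -, -, rfl, rfl, rfl⟩ ⟨a', b', s', t', -, -, -, hs, ht, rfl⟩
  obtain rfl := mul_left_cancel hs
  rw [mul_left_cancel ht]

theorem inv_mul_eq : IsCayleySquare x y z x' → x⁻¹ * y = x'⁻¹ * z := by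
  rintro ⟨a, b, s, t, hab, hs, ht, rfl, rfl, rfl⟩
  rw [(hs.commute ht hab).right_comm, inv_mul_cancel_left, inv_mul_cancel_left]

theorem exists_cube {v x y z p q r : RAAG Γ} :
    IsCayleySquare v x p y → IsCayleySquare v y q z → IsCayleySquare v z r x →
      ∃ s, IsCayleySquare x p s r ∧ IsCayleySquare y q s p ∧ IsCayleySquare z r s q := by
  rintro ⟨a₁, b₁, s, t, h₁, hs₁, ht₁, rfl, rfl, rfl⟩ ⟨a₂, b₂, t', r, h₂, ht₂, hr₂, et, rfl, rfl⟩
    ⟨a₃, b₃, r', s', h₃, hr₃, hs₃, er, rfl, es⟩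
  obtain rfl := mul_left_cancel et
  obtain rfl := mul_left_cancel er
  obtain rfl := mul_left_cancel es
  have hst := (hs₁.commute ht₁ h₁).right_comm
  have htr := (ht₂.commute hr₂ h₂).right_comm
  have hrs := (hr₃.commute hs₃ h₃).right_comm
  refine ⟨v * s * t * r, ⟨a₂, b₂, t, r, h₂, ht₂, hr₂, rfl, rfl, hrs v⟩,
    ⟨a₃, b₃, r, s, h₃, hr₃, hs₃, rfl, ?_, hst v⟩, ⟨a₁, b₁, s, t, h₁, hs₁, ht₁, rfl, ?_, htr v⟩⟩
  · rw [hst, hrs]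
  · rw [htr, hrs]

end IsCayleySquare

variable (Γ) in
/-- The Cayley complex, as the 2-skeleton of the universal cover of the Salvetti complex. -/
def squareComplex : SquareComplex (RAAG Γ) where
  graph := cayley Γ
  IsSquare := IsCayleySquare
  adj_of_isSquare := IsCayleySquare.adj
  ne_of_isSquare := IsCayleySquare.ne
  rotate_isSquare := IsCayleySquare.rotate
  flip_isSquare := IsCayleySquare.flip
  eq_of_isSquare := IsCayleySquare.unique
  exists_cube := IsCayleySquare.exists_cube

section Monodromy

variable {T : Type*} (L : (squareComplex Γ).LocalSystem T)

/-- The total space of a local system on the Cayley complex. -/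
abbrev Total : Type _ := {p : RAAG Γ × T // p.2 ∈ L.fibre p.1}

/-- Transport along the edges labelled by a letter. -/
def move {a : W} {s : RAAG Γ} (hs : IsLetter Γ a s) (p : Total L) : Total L :=
  ⟨(p.1.1 * s, L.transport p.1.1 (p.1.1 * s) p.1.2), L.mapsTo (cayley_adj_mul _ hs) p.2⟩

theorem move_move {a b : W} {s t : RAAG Γ} (hs : IsLetter Γ a s) (ht : IsLetter Γ b t)
    (h : s * t = 1) (p : Total L) : move L ht (move L hs p) = p := by
  have hp : p.1.1 * s * t = p.1.1 := by rw [mul_assoc, h, mul_one]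
  refine Subtype.ext (Prod.ext hp ?_)
  simp only [move, hp]
  exact L.leftInvOn (cayley_adj_mul _ hs) p.2

theorem move_comm {a b : W} {s t : RAAG Γ} (hs : IsLetter Γ a s) (ht : IsLetter Γ b t)
    (h : Γ.Adj a b) (p : Total L) : move L ht (move L hs p) = move L hs (move L ht p) := by
  have hp : p.1.1 * s * t = p.1.1 * t * s := (hs.commute ht h).right_comm _
  refine Subtype.ext (Prod.ext hp ?_)
  simp only [move, ← hp]
  exact L.eqOn ⟨a, b, s, t, h, hs, ht, rfl, rfl, rfl⟩ p.2

/-- The inverse of the transport along the edges labelled by a generator. -/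
def movePerm (a : W) : Equiv.Perm (Total L) where
  toFun := move L (isLetter_gen_inv a)
  invFun := move L (isLetter_gen a)
  left_inv := move_move L _ _ (inv_mul_cancel _)
  right_inv := move_move L _ _ (mul_inv_cancel _)

theorem movePerm_commute {a b : W} (h : Γ.Adj a b) :
    Commute (movePerm L a) (movePerm L b) :=
  Equiv.ext fun p => (move_comm L (isLetter_gen_inv _) (isLetter_gen_inv _) h p).symm

/-- The action of the group on the total space. Transport multiplies labels on the right, so the
generators act by inverse transport. -/
def monodromy : RAAG Γ →* Equiv.Perm (Total L) :=
  lift (movePerm L) fun _ _ h => movePerm_commute L h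

theorem monodromy_gen (a : W) : monodromy L (gen Γ a) = movePerm L a := lift_gen _ _ _

theorem monodromy_inv_letter {a : W} {s : RAAG Γ} (hs : IsLetter Γ a s) (p : Total L) :
    monodromy L s⁻¹ p = move L hs p := by
  rcases hs with rfl | rfl
  · rw [map_inv, monodromy_gen]
    rfl
  · rw [inv_inv, monodromy_gen]
    rfl

theorem monodromy_fst (x : RAAG Γ) (p : Total L) : (monodromy L x p).1.1 = p.1.1 * x⁻¹ := by
  induction x using gen_induction generalizing p with
  | one => simp
  | gen a => rw [monodromy_gen]; rfl
  | mul x y hx hy => rw [map_mul, Equiv.Perm.mul_apply, hx, hy, mul_inv_rev, mul_assoc]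
  | inv x hx =>
    rw [inv_inv, ← mul_inv_eq_iff_eq_mul, ← hx, ← Equiv.Perm.mul_apply, ← map_mul, mul_inv_cancel,
      map_one, Equiv.Perm.one_apply]

end Monodromy

instance : (squareComplex Γ).SimplyConnected where
  connected := cayley_connected
  exists_section L v t ht := by
    refine ⟨fun x => (monodromy L (x⁻¹ * v) ⟨(v, t), ht⟩).1.2, by simp, ?_⟩
    rintro x y ⟨a, hs⟩
    obtain ⟨s, rfl⟩ : ∃ s, y = x * s := ⟨x⁻¹ * y, by simp⟩
    rw [inv_mul_cancel_left] at hs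
    have hx : (monodromy L (x⁻¹ * v) ⟨(v, t), ht⟩).1.1 = x := by
      rw [monodromy_fst]
      simp
    simp only [mul_inv_rev, mul_assoc]
    rw [map_mul, Equiv.Perm.mul_apply, monodromy_inv_letter L hs]
    simp only [move, hx]

theorem inv_mul_eq_of_parallel {a b x y : RAAG Γ} (h : (squareComplex Γ).Parallel a b x y) :
    a⁻¹ * b = x⁻¹ * y := by
  induction h with
  | refl => rfl
  | step _ hq ih => exact ih.trans (IsCayleySquare.inv_mul_eq hq)

theorem inv_mul_eq_of_half_eq {a b x y : RAAG Γ} (hab : (squareComplex Γ).graph.Adj a b)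
    (hxy : (squareComplex Γ).graph.Adj x y)
    (h : (squareComplex Γ).half a b = (squareComplex Γ).half x y) : a⁻¹ * b = x⁻¹ * y :=
  inv_mul_eq_of_parallel (SquareComplex.parallel_of_half_eq hab hxy h)

theorem isAction : (squareComplex Γ).IsAction (RAAG Γ) := by
  rintro g x y ⟨a, h⟩
  exact ⟨a, by simpa [mul_assoc] using h⟩

theorem smul_inv_mul_smul (h a b : RAAG Γ) : (h • a)⁻¹ * (h • b) = a⁻¹ * b := by
  simp [mul_assoc]

theorem isTameAction : (squareComplex Γ).IsTameAction (RAAG Γ) where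
  isAction := isAction
  no_inversion := by
    rintro _ ⟨a, b, hab, rfl⟩ h e
    rw [isAction.smul_half, SquareComplex.compl_half hab] at e
    have hlabel := inv_mul_eq_of_half_eq (isAction h hab) hab.symm e
    rw [smul_inv_mul_smul] at hlabel
    obtain ⟨c, hc⟩ := hab
    exact hc.ne_inv (by simpa using hlabel)
  nested := by
    rintro _ ⟨a, b, hab, rfl⟩ h
    by_contra hn
    have hab' := isAction h hab
    rw [isAction.smul_half] at hn
    obtain ⟨x, y, y', x', hq, hxy, hxx'⟩ := SquareComplex.exists_isSquare_of_transverse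
      (SquareComplex.half_mem_halfspaces hab) (SquareComplex.half_mem_halfspaces hab') hn
    have hlabel := inv_mul_eq_of_half_eq hab hq.adj hxy
    rw [← smul_inv_mul_smul h, inv_mul_eq_of_half_eq hab' hq.flip.adj hxx', mul_right_inj] at hlabel
    exact hq.rotate.ne hlabel.symm
  no_osculation := by
    rintro _ ⟨a, b, hab, rfl⟩ h hlt
    by_contra hn
    have hab' := isAction h hab
    rw [isAction.smul_half] at hlt hn
    obtain ⟨x, y, z, hxy, hyz, hab_eq, hab'_eq⟩ := SquareComplex.exists_adj_adj_of_tight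
      (SquareComplex.half_mem_halfspaces hab)
      (SquareComplex.compl_mem_halfspaces (SquareComplex.half_mem_halfspaces hab')) hlt hn
    have hlabel := inv_mul_eq_of_half_eq hab hxy hab_eq
    rw [← smul_inv_mul_smul h, inv_mul_eq_of_half_eq hab' hyz.symm
      (by rw [← SquareComplex.compl_half hyz, ← hab'_eq, compl_compl]), ← inv_inj] at hlabel
    obtain rfl : x = z := by simpa using hlabel.symm
    have hx : x ∈ (squareComplex Γ).half y x :=
      hab'_eq ▸ hlt.subset (hab_eq ▸ SquareComplex.left_mem_half hxy)
    exact SquareComplex.right_notMem_half hx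

end RAAG

namespace CubeComplex.IsTameAction

variable {V G : Type*} [Group G] [MulAction G V] {X : CubeComplex V}

theorem sclAtLeast (H : X.IsTameAction G) (hX : X.IsCAT0) {g : G} (hg : g ∈ commutator G)
    (hne : ∃ x : V, g • x ≠ x) : SclAtLeast g (1 / 12) :=
  have := hX.simplyConnected.toSquareComplex (hX := hX.flag)
  (H.toSquareComplex (hX := hX.flag)).sclAtLeast hg hne

theorem hasSclGap [FaithfulSMul G V] (H : X.IsTameAction G) (hX : X.IsCAT0) :
    HasSclGap G (1 / 12) := fun g hg hne => H.sclAtLeast hX hg <| by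
  by_contra! hfix
  exact hne (FaithfulSMul.eq_of_smul_eq_smul fun x : V => by rw [hfix, one_smul])

end CubeComplex.IsTameAction

theorem RAAG.hasSclGap {W : Type w} (Γ : SimpleGraph W) : HasSclGap (RAAG Γ) (1 / 12) :=
  fun _ hg hne => RAAG.isTameAction.sclAtLeast hg ⟨1, by simpa using hne⟩

theorem mainTheorem2_general :
    (∀ (G : Type u) [Group G] (V : Type v) [MulAction G V] (X : CubeComplex V),
      X.IsCAT0 → X.IsTameAction G →
        ∀ g ∈ commutator G, (∃ x : V, g • x ≠ x) → SclAtLeast g (1 / 12)) ∧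
    (∀ (G : Type u) [Group G] (V : Type v) [MulAction G V] [FaithfulSMul G V] (X : CubeComplex V),
      X.IsCAT0 → X.IsTameAction G → HasSclGap G (1 / 12)) ∧
    (∀ (W : Type w) (Γ : SimpleGraph W), HasSclGap (RAAG Γ) (1 / 12)) :=
  ⟨fun _ _ _ _ _ hX H _ => H.sclAtLeast hX, fun _ _ _ _ _ _ hX H => H.hasSclGap hX,
    fun _ Γ => RAAG.hasSclGap Γ⟩

theorem mainTheorem2 :
    (∀ (G : Type u) [Group G] (V : Type v) [MulAction G V] (X : CubeComplex V),
      X.IsCAT0 → X.IsRAAGLikeAction G →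
        ∀ g ∈ commutator G, (∃ x : V, g • x ≠ x) → SclAtLeast g (1 / 24)) ∧
    (∀ (G : Type u) [Group G], IsRAAGLikeGroup.{u, v} G → HasSclGap G (1 / 24)) ∧
    (∀ (W : Type w) (Γ : SimpleGraph W), HasSclGap (RAAG Γ) (1 / 24)) := by
  obtain ⟨hscl, hgap, hRAAG⟩ := mainTheorem2_general.{u, v, w}
  exact ⟨fun G _ V _ X hX H g hg hne => (hscl G V X hX H.isTameAction g hg hne).mono (by norm_num),
    fun G _ ⟨V, _, X, hX, H, _⟩ g hg hne =>
      (hgap G V X hX H.isTameAction g hg hne).mono (by norm_num),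
    fun W Γ g hg hne => (hRAAG W Γ g hg hne).mono (by norm_num)⟩
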